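/- **Setting.** Graphs are finite, simple and undirected, on the node set $V=\{0,\dots,n-1\}$, $n\ge 1$; $d=2|E|/n$ is the average degree. In the sparse graph model a graph $G=(V,E)$ is *$\epsilon$-far* from a property $\mathcal P$ if it cannot be transformed into a graph on $V$ with property $\mathcal P$ by at most $\epsilon|E|$ edge insertions and deletions. A graph is *connected* if it has a node and any two nodes are joined by a path, *$k$-edge-connected* if removing fewer than $k$ edges always leaves a connected graph, and *eulerian* if it has a closed walk that traverses each edge exactly once. In the incidence-list model, the input graph is given by an arbitrarily ordered list of the neighbours of each node. A randomized adaptive algorithm, which is given $n$ and further parameters, may draw a uniformly random node, ask for the degree of a node, or ask for the $i$-th neighbour of a node; each of these counts as one query. The number of queries of an algorithm on an input is its maximum over all outcomes of the random draws. A property $\mathcal P$ *has a one-sided tester with complexity* $O(f)$ if there are a constant $C$ and a family of such algorithms, which are given $n$, $\epsilon>0$, $p\in[0,1)$ and $d$, such that for all $n$, $\epsilon$, $p$, every graph $G$ on $n$ nodes with average degree $d$ and every incidence-list representation of $G$: (i) if $G$ has property $\mathcal P$, the algorithm accepts with probability $1$; (ii) if $G$ is $\epsilon$-far from $\mathcal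 P$, the algorithm rejects with probability at least $p$; (iii) if $d>0$, the algorithm makes at most $C\cdot f(\epsilon,p,d)$ queries. **Theorem.** Let $Q(p)=\max\{1,-\log(1-p)\}$ and $\Lambda(\epsilon,d)=\max\{1,\log\frac{1}{\epsilon d}\}$. Then connectivity, $2$-edge-connectivity and eulerianity have one-sided testers with complexity $$O\left(\frac{Q(p)\,\Lambda(\epsilon,d)}{\epsilon^2d^2}\right),$$ and $3$-edge-connectivity has a one-sided tester with complexity $$O\left(\frac{Q(p)\,\Lambda(\epsilon,d)}{\epsilon^3d^3}\right).$$ The claim for eulerianity also holds if eulerian graphs are in addition required to be connected (that is, to have no isolated nodes besides the case of a single node). In particular, for $p\ge 1-1/e$ and $0<\epsilon d\le 1/e$, the query complexities are $O\left(-\log(1-p)\,\frac{\log(1/(\epsilon d))}{\epsilon^2d^2}\right)$ and $O\left(-\log(1-p)\,\frac{\log(1/(\epsilon d))}{\epsilon^3d^3}\right)$, respectively. -/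

import Mathlib

namespace SparseGraphTesting

/-- An incidence-list representation of a graph on the nodes `0, …, n - 1`: every node comes with
a list of its neighbours, each occurring exactly once, in an arbitrary order. -/
structure IncidenceLists {n : ℕ} (G : SimpleGraph (Fin n)) where
  list : Fin n → List (Fin n)
  nodup : ∀ v, (list v).Nodup
  mem_iff : ∀ v w, w ∈ list v ↔ G.Adj v w

/-- A randomized adaptive algorithm in the incidence-list model on `n` nodes, as a decision tree.
It may draw a uniformly random node, ask for the degree of a node, ask for the `i`-th neighbour of
a node (counted from `0`; the answer is `none` if there is no such neighbour), and finally answers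
`true` (accept) or `false` (reject). -/
inductive Algorithm (n : ℕ) : Type
  | answer (b : Bool) : Algorithm n
  | sample (next : Fin n → Algorithm n) : Algorithm n
  | degree (v : Fin n) (next : ℕ → Algorithm n) : Algorithm n
  | neighbor (v : Fin n) (i : ℕ) (next : Option (Fin n) → Algorithm n) : Algorithm n

/-- The distribution of the answer of an algorithm on a given input; the samples are independent
and uniformly distributed over the nodes. -/
noncomputable def Algorithm.run {n : ℕ} [NeZero n] {G : SimpleGraph (Fin n)}
    (L : IncidenceLists G) : Algorithm n → PMF Bool
  | .answer b => PMF.pure b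
  | .sample next => (PMF.uniformOfFintype (Fin n)).bind fun v => (next v).run L
  | .degree v next => (next (L.list v).length).run L
  | .neighbor v i next => (next (L.list v)[i]?).run L

/-- The worst-case (over all outcomes of the samples) number of queries of an algorithm on a given
input, where degree queries, neighbour queries and samples each count as one query. -/
def Algorithm.queries {n : ℕ} {G : SimpleGraph (Fin n)}
    (L : IncidenceLists G) : Algorithm n → ℕ
  | .answer _ => 0
  | .sample next => 1 + Finset.univ.sup fun v => (next v).queries L
  | .degree v next => 1 + (next (L.list v).length).queries L
  | .neighbor v i next => 1 + (next (L.list v)[i]?).queries L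

/-- The average degree `d = 2 |E| / |V|`. -/
noncomputable def avgDegree {n : ℕ} (G : SimpleGraph (Fin n)) : ℝ :=
  2 * (G.edgeSet.ncard : ℝ) / n

/-- `G` is `ε`-far from `P` (sparse graph model): it cannot be transformed into a graph with
property `P` by at most `ε |E|` edge insertions and deletions. -/
def IsFar {n : ℕ} (ε : ℝ) (P : SimpleGraph (Fin n) → Prop) (G : SimpleGraph (Fin n)) : Prop :=
  ∀ H : SimpleGraph (Fin n), P H →
    ε * (G.edgeSet.ncard : ℝ) < ((symmDiff G.edgeSet H.edgeSet).ncard : ℝ)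

/-- `G` has a closed walk that traverses each edge exactly once. -/
def IsEulerian {n : ℕ} (G : SimpleGraph (Fin n)) : Prop :=
  ∃ (v : Fin n) (w : G.Walk v v), w.IsEulerian

/-- There is a one-sided tester for the graph property `P` with query complexity
`O(-log (1 - p) * log (1 / (ε d)) / (ε d) ^ a)`. The tester is given `n`, `ε`, `p` and the average
degree `d`. Both logarithmic factors are understood to be at least `1`. -/
def HasTester (P : ∀ n : ℕ, SimpleGraph (Fin n) → Prop) (a : ℕ) : Prop :=
  ∃ (C : ℝ) (T : ∀ n : ℕ, (ε p d : ℝ) → Algorithm n),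
    ∀ (n : ℕ) [NeZero n] (ε p : ℝ), 0 < ε → 0 ≤ p → p < 1 →
      ∀ (G : SimpleGraph (Fin n)) (L : IncidenceLists G),
        (P n G → (T n ε p (avgDegree G)).run L true = 1) ∧
        (IsFar ε (P n) G → ENNReal.ofReal p ≤ (T n ε p (avgDegree G)).run L false) ∧
        (0 < avgDegree G →
          ((T n ε p (avgDegree G)).queries L : ℝ) ≤
            C * (max 1 (-Real.log (1 - p)) * max 1 (Real.log (1 / (ε * avgDegree G)))) /
              (ε * avgDegree G) ^ a)

end SparseGraphTesting

/-! A graph far from the property contains many pairwise disjoint witnesses, each recognisable from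
any of its nodes at a cost quadratic in its size. If ε|E| ≤ K|𝓢| for a disjoint family 𝓢, then |𝓢| ≥
εdn/(2K), and enough of its sets have size O(K/(εd)). `levelTester` tries all sizes 2^i up to this
bound: it draws about C/(2^i εd) start nodes and pays O(4^i) for each. The costs form a geometric
series dominated by the largest scale, so `hasTester_of_localTest` really yields O(Q(p)/(εd)²), for
every k in the case of k-edge-connectivity. The factor Λ and the third power are slack, inserted by
`queries_bound_of_sq`.

For k-edge-connectivity the witnesses are the minimal sets left by fewer than k edges. They are
disjoint by posimodularity of cuts, and k + 1 new edges per set repair the graph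
(`exists_isEdgeConnected`). To detect such a set S with |S| ≤ t from v ∈ S without knowing S,
`cutTest` builds a flow out of v by augmenting paths. A residual search visits at most 2t + 1 nodes.
If it gets stuck earlier, the visited set is saturated, so its cut is at most the number of units
sent, and the test rejects. Otherwise one more unit is sent to a node of degree above t + k, which
cannot lie in S, or to a random visited node, which lies outside S with probability at least 1/4.
After k - 1 units have left S, it is saturated and the search gets stuck inside it.

For eulerianity the witnesses are the nodes of odd degree or the components, whichever are more
numerous. Odd degrees are repaired by toggling edges between odd nodes, and components are joined by
toggling triangles, which keeps all parities. The same search with zero flow explores a component.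
-/

namespace SparseGraphTesting

/-! ### Decision trees: acceptance probabilities and query counts -/

namespace IncidenceLists

variable {n : ℕ} {G : SimpleGraph (Fin n)}

/-- The set of neighbours of a node. -/
def nbrs (L : IncidenceLists G) (v : Fin n) : Finset (Fin n) := (L.list v).toFinset

@[simp] lemma mem_nbrs (L : IncidenceLists G) (v w : Fin n) : w ∈ L.nbrs v ↔ G.Adj v w := by
  simp [nbrs, L.mem_iff]

lemma card_nbrs (L : IncidenceLists G) (v : Fin n) : (L.nbrs v).card = (L.list v).length :=
  List.toFinset_card_of_nodup (L.nodup v)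

lemma card_nbrs_le (L : IncidenceLists G) (v : Fin n) : (L.nbrs v).card ≤ n := by
  simpa using Finset.card_le_univ (L.nbrs v)

end IncidenceLists

namespace Algorithm

variable {n : ℕ} {G : SimpleGraph (Fin n)}

/-- The probability that an algorithm accepts, as a real number. -/
noncomputable def acc (L : IncidenceLists G) : Algorithm n → ℝ
  | .answer b => if b then 1 else 0
  | .sample next => (∑ v, (next v).acc L) / n
  | .degree v next => (next (L.list v).length).acc L
  | .neighbor v i next => (next (L.list v)[i]?).acc L

lemma acc_nonneg (L : IncidenceLists G) (A : Algorithm n) : 0 ≤ A.acc L := by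
  induction A with
  | answer b => cases b <;> simp [acc]
  | sample next ih => exact div_nonneg (Finset.sum_nonneg fun v _ => ih v) (Nat.cast_nonneg n)
  | degree v next ih => exact ih _
  | neighbor v i next ih => exact ih _

lemma acc_sample_le (L : IncidenceLists G) [NeZero n] (next : Fin n → Algorithm n) {b : ℝ}
    (h : ∑ v, (next v).acc L ≤ b * n) : (Algorithm.sample next).acc L ≤ b := by
  have : (0 : ℝ) < n := by exact_mod_cast Nat.pos_of_ne_zero (NeZero.ne n)
  rw [acc, div_le_iff₀ this]
  exact h

lemma acc_le_one (L : IncidenceLists G) [NeZero n] (A : Algorithm n) : A.acc L ≤ 1 := by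
  induction A with
  | answer b => cases b <;> simp [acc]
  | sample next ih =>
    refine acc_sample_le L next ?_
    simpa using Finset.sum_le_sum fun v (_ : v ∈ Finset.univ) => ih v
  | degree v next ih => exact ih _
  | neighbor v i next ih => exact ih _

lemma acc_sample_eq_one (L : IncidenceLists G) [NeZero n] (next : Fin n → Algorithm n)
    (h : ∀ v, (next v).acc L = 1) : (Algorithm.sample next).acc L = 1 := by
  simp [acc, h, NeZero.ne n]

lemma run_true (L : IncidenceLists G) [NeZero n] (A : Algorithm n) :
    A.run L true = ENNReal.ofReal (A.acc L) := by
  induction A with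
  | answer b => cases b <;> simp [acc, run, PMF.pure_apply]
  | sample next ih =>
    have hn : (0 : ℝ) < n := by exact_mod_cast Nat.pos_of_ne_zero (NeZero.ne n)
    simp only [run, PMF.bind_apply, tsum_fintype, PMF.uniformOfFintype_apply, Fintype.card_fin,
      ih, acc]
    rw [← Finset.mul_sum, ENNReal.ofReal_div_of_pos hn,
      ENNReal.ofReal_sum_of_nonneg fun v _ => acc_nonneg L _, ENNReal.ofReal_natCast, mul_comm]
    rfl
  | degree v next ih => exact ih _
  | neighbor v i next ih => exact ih _

lemma run_false (L : IncidenceLists G) [NeZero n] (A : Algorithm n) :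
    A.run L false = ENNReal.ofReal (1 - A.acc L) := by
  have h := (A.run L).tsum_coe
  rw [tsum_fintype, Fintype.sum_bool, run_true] at h
  rw [ENNReal.ofReal_sub _ (acc_nonneg L A), ENNReal.ofReal_one, ← h,
    ENNReal.add_sub_cancel_left ENNReal.ofReal_ne_top]

/-- Run `A`, and if it accepts, run `B`. -/
def seq : Algorithm n → Algorithm n → Algorithm n
  | .answer b, B => if b then B else .answer false
  | .sample next, B => .sample fun v => (next v).seq B
  | .degree v next, B => .degree v fun m => (next m).seq B
  | .neighbor v i next, B => .neighbor v i fun o => (next o).seq B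

lemma acc_seq (L : IncidenceLists G) (A B : Algorithm n) :
    (A.seq B).acc L = A.acc L * B.acc L := by
  induction A with
  | answer b => cases b <;> simp [acc, seq]
  | sample next ih => simp only [acc, seq, ih, ← Finset.sum_mul]; ring
  | degree v next ih => exact ih _
  | neighbor v i next ih => exact ih _

lemma queries_seq (L : IncidenceLists G) (A B : Algorithm n) :
    (A.seq B).queries L ≤ A.queries L + B.queries L := by
  induction A with
  | answer b => cases b <;> simp [queries, seq]
  | sample next ih =>
    simp only [queries, seq]
    have : (Finset.univ.sup fun v => ((next v).seq B).queries L) ≤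
        (Finset.univ.sup fun v => (next v).queries L) + B.queries L :=
      Finset.sup_le fun v hv => (ih v).trans
        (Nat.add_le_add_right (Finset.le_sup (f := fun v => (next v).queries L) hv) _)
    omega
  | degree v next ih =>
    have := ih (L.list v).length
    simp only [queries, seq]
    omega
  | neighbor v i next ih =>
    have := ih (L.list v)[i]?
    simp only [queries, seq]
    omega

/-- Run the algorithms `A 0, …, A (m - 1)`, and accept if all of them accept. -/
def seqRange (A : ℕ → Algorithm n) : ℕ → Algorithm n
  | 0 => .answer true
  | m + 1 => (seqRange A m).seq (A m)

lemma acc_seqRange (L : IncidenceLists G) (A : ℕ → Algorithm n) (m : ℕ) :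
    (seqRange A m).acc L = ∏ i ∈ Finset.range m, (A i).acc L := by
  induction m with
  | zero => simp [seqRange, acc]
  | succ m ih => rw [seqRange, acc_seq, ih, Finset.prod_range_succ]

lemma queries_seqRange (L : IncidenceLists G) (A : ℕ → Algorithm n) (m : ℕ) :
    (seqRange A m).queries L ≤ ∑ i ∈ Finset.range m, (A i).queries L := by
  induction m with
  | zero => simp [seqRange, queries]
  | succ m ih =>
    rw [seqRange, Finset.sum_range_succ]
    exact (queries_seq L _ _).trans (Nat.add_le_add_right ih _)

/-- On the given input, `A` behaves like `B` after at most `c` additional queries. -/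
def Reduces (L : IncidenceLists G) (c : ℕ) (A B : Algorithm n) : Prop :=
  A.acc L = B.acc L ∧ A.queries L ≤ c + B.queries L

lemma Reduces.refl (L : IncidenceLists G) (A : Algorithm n) : Reduces L 0 A A := ⟨rfl, by simp⟩

lemma Reduces.trans {L : IncidenceLists G} {c₁ c₂ : ℕ} {A₁ A₂ A₃ : Algorithm n}
    (h₁ : Reduces L c₁ A₁ A₂) (h₂ : Reduces L c₂ A₂ A₃) : Reduces L (c₁ + c₂) A₁ A₃ :=
  ⟨h₁.1.trans h₂.1, by have := h₁.2; have := h₂.2; omega⟩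

lemma Reduces.mono {L : IncidenceLists G} {c₁ c₂ : ℕ} {A₁ A₂ : Algorithm n}
    (h₁ : Reduces L c₁ A₁ A₂) (h : c₁ ≤ c₂) : Reduces L c₂ A₁ A₂ :=
  ⟨h₁.1, h₁.2.trans (Nat.add_le_add_right h _)⟩

/-- Ask for the first `m` neighbours of `v`, and pass the set of the answers, together with
`s`, to `next`. -/
def collect (v : Fin n) (next : Finset (Fin n) → Algorithm n) :
    ℕ → Finset (Fin n) → Algorithm n
  | 0, s => next s
  | m + 1, s => .neighbor v m fun o => collect v next m (o.toFinset ∪ s)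

lemma reduces_collect (L : IncidenceLists G) (v : Fin n) (next : Finset (Fin n) → Algorithm n)
    (m : ℕ) (s : Finset (Fin n)) :
    Reduces L m (collect v next m s) (next (((L.list v).take m).toFinset ∪ s)) := by
  induction m generalizing s with
  | zero => simpa [collect] using Reduces.refl L _
  | succ m ih =>
    have h := ih ((L.list v)[m]?.toFinset ∪ s)
    have e : ((L.list v).take (m + 1)).toFinset ∪ s =
        ((L.list v).take m).toFinset ∪ ((L.list v)[m]?.toFinset ∪ s) := by
      rw [List.take_add_one, List.toFinset_append, Finset.union_assoc]
      congr 2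
      ext x
      simp
    rw [e]
    refine ⟨h.1, ?_⟩
    have := h.2
    simp only [collect, queries]
    omega

/-- Ask for the degree of `v`. If it is larger than `D`, continue with `high`, otherwise read the
list of `v` and pass the set of neighbours to `next`. -/
def readVertex (v : Fin n) (D : ℕ) (high : Algorithm n) (next : Finset (Fin n) → Algorithm n) :
    Algorithm n :=
  .degree v fun m => if D < m then high else collect v next m ∅

lemma reduces_readVertex_high (L : IncidenceLists G) {v : Fin n} {D : ℕ} (high : Algorithm n)
    (next : Finset (Fin n) → Algorithm n) (h : D < (L.nbrs v).card) :
    Reduces L (D + 1) (readVertex v D high next) high := by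
  rw [L.card_nbrs] at h
  refine ⟨?_, ?_⟩ <;> simp only [readVertex, acc, queries, if_pos h]
  omega

lemma reduces_readVertex (L : IncidenceLists G) {v : Fin n} {D : ℕ} (high : Algorithm n)
    (next : Finset (Fin n) → Algorithm n) (h : (L.nbrs v).card ≤ D) :
    Reduces L (D + 1) (readVertex v D high next) (next (L.nbrs v)) := by
  rw [L.card_nbrs] at h
  have := reduces_collect L v next (L.list v).length ∅
  rw [List.take_length, Finset.union_empty] at this
  refine ⟨?_, ?_⟩ <;> simp only [readVertex, acc, queries, if_neg h.not_gt]
  · exact this.1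
  · have := this.2
    simp only [IncidenceLists.nbrs]
    omega

/-- Read the lists of the nodes in the given list, and pass all neighbourhoods to `next`. -/
def readAll (next : (Fin n → Finset (Fin n)) → Algorithm n) :
    List (Fin n) → (Fin n → Finset (Fin n)) → Algorithm n
  | [], N => next N
  -- No degree exceeds n, so the branch for high degrees is never taken.
  | v :: l, N => readVertex v n (.answer true) fun s => readAll next l (Function.update N v s)

lemma reduces_readAll (L : IncidenceLists G) (next : (Fin n → Finset (Fin n)) → Algorithm n)
    (l : List (Fin n)) (N : Fin n → Finset (Fin n)) (hN : ∀ v, v ∉ l → N v = L.nbrs v) :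
    Reduces L (l.length * (n + 1)) (readAll next l N) (next L.nbrs) := by
  induction l generalizing N with
  | nil =>
    obtain rfl : N = L.nbrs := funext fun v => hN v (by simp)
    simpa [readAll] using Reduces.refl L _
  | cons v l ih =>
    refine ((reduces_readVertex L _ _ (L.card_nbrs_le v)).trans (ih _ ?_)).mono (le_of_eq ?_)
    · intro u hu
      by_cases h : u = v
      · subst h; simp
      · rw [Function.update_of_ne h]
        exact hN u (by simp [h, hu])
    · simp only [List.length_cons]; ring

open Classical in
/-- Read the whole graph and decide the property `P`. -/
noncomputable def readGraph (P : SimpleGraph (Fin n) → Prop) : Algorithm n :=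
  readAll (fun N => .answer (decide (P (SimpleGraph.fromRel fun u w => w ∈ N u))))
    (List.finRange n) fun _ => ∅

open Classical in
lemma reduces_readGraph (L : IncidenceLists G) (P : SimpleGraph (Fin n) → Prop) :
    Reduces L (n * (n + 1)) (readGraph P) (.answer (decide (P G))) := by
  have h := reduces_readAll L
    (fun N => .answer (decide (P (SimpleGraph.fromRel fun u w => w ∈ N u))))
    (List.finRange n) (fun _ => ∅) (by simp)
  have e : (SimpleGraph.fromRel fun u w => w ∈ L.nbrs u) = G := by
    ext u w
    simp only [SimpleGraph.fromRel_adj, L.mem_nbrs]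
    exact ⟨fun h => h.2.elim id fun h => h.symm, fun h => ⟨h.ne, Or.inl h⟩⟩
  simp only [e, List.length_finRange] at h
  exact h

end Algorithm

/-! ### From local tests to testers: sampling at dyadic scales -/

namespace Algorithm

variable {n : ℕ} {G : SimpleGraph (Fin n)}

lemma acc_sample_le_sub (L : IncidenceLists G) [NeZero n] (A : Fin n → Algorithm n)
    (U : Finset (Fin n)) {δ : ℝ} (h : ∀ v ∈ U, (A v).acc L ≤ 1 - δ) :
    (Algorithm.sample A).acc L ≤ 1 - δ * U.card / n := by
  have hn : (0 : ℝ) < n := by exact_mod_cast Nat.pos_of_ne_zero (NeZero.ne n)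
  have h1 : ∑ v, (A v).acc L ≤ ∑ v, (1 - if v ∈ U then δ else 0) := by
    refine Finset.sum_le_sum fun v _ => ?_
    split_ifs with hv
    · exact h v hv
    · simpa using acc_le_one L _
  have h2 : ∑ v : Fin n, (1 - if v ∈ U then δ else 0) = n - U.card * δ := by
    simp [Finset.sum_sub_distrib]
  rw [h2] at h1
  refine acc_sample_le L A (h1.trans (le_of_eq ?_))
  field_simp

/-- By 1 - x ≤ exp(-x), the rejection probabilities of successive runs add up in the exponent. -/
lemma acc_sample_le_exp (L : IncidenceLists G) [NeZero n] (A : Fin n → Algorithm n)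
    (U : Finset (Fin n)) {δ : ℝ} (h : ∀ v ∈ U, (A v).acc L ≤ 1 - δ) :
    (Algorithm.sample A).acc L ≤ Real.exp (-(δ * U.card / n)) := by
  have := Real.add_one_le_exp (-(δ * U.card / n))
  linarith [acc_sample_le_sub L A U h]

end Algorithm

/-- The number of samples that are used for the sets of size about `2 ^ i`. -/
noncomputable def numSamples (C x : ℝ) (i : ℕ) : ℕ := ⌈C / (2 ^ i * x)⌉₊

/-- Given the local test `A`, which gets a size bound and a start node, run it with size bounds
`1, 2, …, 2 ^ I` from random start nodes. -/
noncomputable def levelTester {n : ℕ} (A : ℕ → Fin n → Algorithm n) (C x : ℝ) (I : ℕ) :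
    Algorithm n :=
  .seqRange (fun i => .seqRange (fun _ => .sample (A (2 ^ i))) (numSamples C x i)) (I + 1)

section levelTester

variable {n : ℕ} {G : SimpleGraph (Fin n)}

lemma acc_levelTester_of_sound [NeZero n] (L : IncidenceLists G) (A : ℕ → Fin n → Algorithm n)
    (C x : ℝ) (I : ℕ) (h : ∀ t v, (A t v).acc L = 1) : (levelTester A C x I).acc L = 1 := by
  simp [levelTester, Algorithm.acc_seqRange, Algorithm.acc_sample_eq_one L _ (h _)]

/-- Level i costs O(C · 2^i / x), so the last level dominates. The hypothesis `hI` keeps C/(2^i x)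
at least 1, so that rounding up at most doubles the number of samples. -/
lemma queries_levelTester_le (L : IncidenceLists G) (A : ℕ → Fin n → Algorithm n) {C x : ℝ}
    {I c : ℕ} (hx : 0 < x) (hI : 2 ^ I * x ≤ C)
    (h : ∀ i v, (A (2 ^ i) v).queries L ≤ c * (2 ^ i) ^ 2) :
    ((levelTester A C x I).queries L : ℝ) ≤ 4 * (1 + c) * C * 2 ^ I / x := by
  have h1 : (levelTester A C x I).queries L ≤
      ∑ i ∈ Finset.range (I + 1), numSamples C x i * (1 + c * (2 ^ i) ^ 2) := by
    refine (Algorithm.queries_seqRange L _ _).trans (Finset.sum_le_sum fun i _ => ?_)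
    refine (Algorithm.queries_seqRange L _ _).trans ?_
    rw [Finset.sum_const, Finset.card_range, smul_eq_mul]
    refine Nat.mul_le_mul_left _ ?_
    exact Nat.add_le_add_left (Finset.sup_le fun v _ => h i v) 1
  have h2 : ∀ i ∈ Finset.range (I + 1),
      ((numSamples C x i * (1 + c * (2 ^ i) ^ 2) : ℕ) : ℝ) ≤ 2 * (1 + c) * C / x * 2 ^ i := by
    intro i hi
    have hp : (0 : ℝ) < 2 ^ i := by positivity
    have hp1 : (1 : ℝ) ≤ 2 ^ i := one_le_pow₀ (by norm_num)
    have hiI : (2 : ℝ) ^ i ≤ 2 ^ I :=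
      pow_le_pow_right₀ (by norm_num) (Nat.lt_succ_iff.mp (Finset.mem_range.mp hi))
    have hq : 1 ≤ C / (2 ^ i * x) := by
      rw [le_div_iff₀ (by positivity), one_mul]
      exact (mul_le_mul_of_nonneg_right hiI hx.le).trans hI
    have hm : (numSamples C x i : ℝ) ≤ 2 * (C / (2 ^ i * x)) := by
      have := (Nat.ceil_lt_add_one (a := C / (2 ^ i * x)) (by linarith)).le
      rw [numSamples]
      linarith
    have hc : (1 + c * (2 ^ i) ^ 2 : ℝ) ≤ (1 + c) * (2 ^ i) ^ 2 := by
      nlinarith [one_le_pow₀ (n := 2) hp1]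
    push_cast
    refine (mul_le_mul hm hc (by positivity) (by linarith)).trans (le_of_eq ?_)
    field_simp
  have h3 : ∑ i ∈ Finset.range (I + 1), (2 : ℝ) ^ i ≤ 2 * 2 ^ I := by
    rw [geom_sum_eq (by norm_num)]
    rw [pow_succ]; norm_num; linarith
  have hC : 0 < C := lt_of_lt_of_le (by positivity) hI
  calc ((levelTester A C x I).queries L : ℝ)
      ≤ ∑ i ∈ Finset.range (I + 1), ((numSamples C x i * (1 + c * (2 ^ i) ^ 2) : ℕ) : ℝ) := by
        exact_mod_cast h1
    _ ≤ ∑ i ∈ Finset.range (I + 1), 2 * (1 + c) * C / x * 2 ^ i := Finset.sum_le_sum h2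
    _ ≤ 2 * (1 + c) * C / x * (2 * 2 ^ I) := by
        rw [← Finset.mul_sum]
        exact mul_le_mul_of_nonneg_left h3 (by positivity)
    _ = _ := by ring

/-- Each set is charged to the level i = ⌈log₂ |S|⌉. By disjointness the sets of level i cover at
least 2^i/2 nodes each, so the C/(2^i x) samples contribute δC/(2xn) per set to the exponent,
independently of i. -/
lemma acc_levelTester_le [NeZero n] (L : IncidenceLists G) (A : ℕ → Fin n → Algorithm n) {C x δ : ℝ}
    {I : ℕ} (hx : 0 < x) (hC : 0 ≤ C) (hδ : 0 ≤ δ) (𝓢 : Finset (Finset (Fin n)))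
    (hdisj : (𝓢 : Set (Finset (Fin n))).PairwiseDisjoint id) (hne : ∀ S ∈ 𝓢, S.Nonempty)
    (hcard : ∀ S ∈ 𝓢, S.card ≤ 2 ^ I)
    (h : ∀ S ∈ 𝓢, ∀ i ≤ I, S.card ≤ 2 ^ i → ∀ v ∈ S, (A (2 ^ i) v).acc L ≤ 1 - δ) :
    (levelTester A C x I).acc L ≤ Real.exp (-(δ * C * 𝓢.card / (2 * x * n))) := by
  classical
  have hn : (0 : ℝ) < n := by exact_mod_cast Nat.pos_of_ne_zero (NeZero.ne n)
  have hlog : ∀ S ∈ 𝓢, Nat.clog 2 S.card ∈ Finset.range (I + 1) := fun S hS =>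
    Finset.mem_range.mpr (Nat.lt_succ_iff.mpr (Nat.clog_le_of_le_pow (hcard S hS)))
  let F : ℕ → Finset (Finset (Fin n)) := fun i => 𝓢.filter fun S => Nat.clog 2 S.card = i
  let U : ℕ → Finset (Fin n) := fun i => (F i).biUnion id
  have hU : ∀ i, (2 : ℝ) ^ i * (F i).card ≤ 2 * (U i).card := by
    intro i
    have e : (U i).card = ∑ S ∈ F i, S.card :=
      Finset.card_biUnion fun S hS T hT hne => hdisj (Finset.mem_filter.mp hS).1
        (Finset.mem_filter.mp hT).1 hne
    have : 2 ^ i * (F i).card ≤ 2 * (U i).card := by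
      rw [e, mul_comm, ← smul_eq_mul, ← Finset.sum_const, Finset.mul_sum]
      refine Finset.sum_le_sum fun S hS => ?_
      obtain ⟨hS𝓢, rfl⟩ := Finset.mem_filter.mp hS
      have hpos := (hne S hS𝓢).card_pos
      rcases Nat.lt_or_ge 1 S.card with h1 | h1
      · have h2 := Nat.pow_pred_clog_lt_self (b := 2) (by norm_num) h1
        have h3 : 0 < Nat.clog 2 S.card := Nat.clog_pos (by norm_num) h1
        obtain ⟨j, hj⟩ := Nat.exists_eq_succ_of_ne_zero h3.ne'
        rw [hj] at h2 ⊢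
        rw [pow_succ]
        simp only [Nat.pred_succ] at h2
        omega
      · have : S.card = 1 := by omega
        simp [this]
    exact_mod_cast this
  have hstep : ∀ i ∈ Finset.range (I + 1),
      (Algorithm.seqRange (fun _ => .sample (A (2 ^ i))) (numSamples C x i)).acc L ≤
        Real.exp (-(δ * C / (2 * x * n) * (F i).card)) := by
    intro i hi
    rw [Algorithm.acc_seqRange, Finset.prod_const, Finset.card_range]
    have h1 := Algorithm.acc_sample_le_exp L (A (2 ^ i)) (U i) (δ := δ) (by
      intro v hv
      obtain ⟨S, hS, hvS⟩ := Finset.mem_biUnion.mp hv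
      obtain ⟨hS𝓢, rfl⟩ := Finset.mem_filter.mp hS
      exact h S hS𝓢 _ (Nat.lt_succ_iff.mp (Finset.mem_range.mp hi))
        (Nat.le_pow_clog (by norm_num) _) v hvS)
    refine (pow_le_pow_left₀ (Algorithm.acc_nonneg L _) h1 _).trans ?_
    rw [← Real.exp_nat_mul, Real.exp_le_exp, mul_neg, neg_le_neg_iff]
    have h2 : C / (2 ^ i * x) ≤ numSamples C x i := Nat.le_ceil _
    calc δ * C / (2 * x * n) * (F i).card
        = δ * C / (2 * x * n * 2 ^ i) * (2 ^ i * (F i).card) := by field_simp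
      _ ≤ δ * C / (2 * x * n * 2 ^ i) * (2 * (U i).card) :=
          mul_le_mul_of_nonneg_left (hU i) (by positivity)
      _ = C / (2 ^ i * x) * (δ * (U i).card / n) := by field_simp
      _ ≤ _ := mul_le_mul_of_nonneg_right h2 (by positivity)
  rw [levelTester, Algorithm.acc_seqRange]
  refine (Finset.prod_le_prod (fun i _ => Algorithm.acc_nonneg L _) hstep).trans ?_
  rw [← Real.exp_sum, Real.exp_le_exp, Finset.sum_neg_distrib, ← Finset.mul_sum,
    Finset.card_eq_sum_card_fiberwise hlog]
  push_cast
  exact le_of_eq (by ring)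

end levelTester

/-- Weakens a quadratic bound to the required form: Λ ≥ 1 is inserted for free, and every further
power of 1/x costs a factor X. -/
lemma queries_bound_of_sq {q B Q Λ x X : ℝ} {a : ℕ} (ha : 2 ≤ a) (hx : 0 < x) (hxX : x ≤ X)
    (hB : 0 ≤ B) (hQ : 0 ≤ Q) (hΛ : 1 ≤ Λ) (h : q ≤ B * Q / x ^ 2) :
    q ≤ X ^ (a - 2) * B * (Q * Λ) / x ^ a := by
  obtain ⟨b, rfl⟩ := Nat.exists_eq_add_of_le ha
  have h1 : x ^ b ≤ X ^ b := pow_le_pow_left₀ hx.le hxX b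
  have h2 : B * Q ≤ B * (Q * Λ) :=
    mul_le_mul_of_nonneg_left (le_mul_of_one_le_right hQ hΛ) hB
  refine h.trans ?_
  rw [div_le_div_iff₀ (by positivity) (by positivity), Nat.add_sub_cancel_left, pow_add]
  calc B * Q * (x ^ 2 * x ^ b) = x ^ b * (B * Q) * x ^ 2 := by ring
    _ ≤ X ^ b * (B * (Q * Λ)) * x ^ 2 := by
      refine mul_le_mul_of_nonneg_right ?_ (by positivity)
      exact mul_le_mul h1 h2 (by positivity) (le_trans (by positivity) h1)
    _ = _ := by ring

lemma not_isFar_of_prop {n : ℕ} {P : SimpleGraph (Fin n) → Prop} {G : SimpleGraph (Fin n)}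
    {ε : ℝ} (hε : 0 < ε) (h : P G) : ¬ IsFar ε P G := by
  intro hf
  have := hf G h
  simp only [symmDiff_self, Set.bot_eq_empty, Set.ncard_empty, Nat.cast_zero] at this
  exact absurd this (not_lt.mpr (by positivity))

lemma mul_avgDegree {n : ℕ} [NeZero n] (G : SimpleGraph (Fin n)) :
    n * avgDegree G = 2 * G.edgeSet.ncard := by
  have hn : (n : ℝ) ≠ 0 := by exact_mod_cast NeZero.ne n
  rw [avgDegree]
  field_simp

lemma exp_neg_max_le {p : ℝ} (hp : p < 1) : Real.exp (-max 1 (-Real.log (1 - p))) ≤ 1 - p := by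
  rw [← Real.le_log_iff_exp_le (by linarith)]
  linarith [le_max_right 1 (-Real.log (1 - p))]

/-- At least half of the sets in a large disjoint family are small. -/
lemma card_small_sets {n : ℕ} (𝓢 : Finset (Finset (Fin n)))
    (hdisj : (𝓢 : Set (Finset (Fin n))).PairwiseDisjoint id) {s : ℕ} {M : ℝ}
    (hM0 : 0 ≤ M) (hM : 2 * M ≤ 𝓢.card) (hs : n ≤ M * s) :
    M ≤ (𝓢.filter fun S => S.card ≤ s).card := by
  classical
  have h1 : (𝓢.filter fun S => ¬ S.card ≤ s).card * (s + 1) ≤ n := by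
    rw [← smul_eq_mul, ← Finset.sum_const]
    refine (Finset.sum_le_sum (g := Finset.card) fun S hS => ?_).trans ?_
    · have := (Finset.mem_filter.mp hS).2
      omega
    · have := Finset.card_biUnion (s := 𝓢.filter fun S => ¬ S.card ≤ s) (t := id)
        fun S hS T hT hne => hdisj (Finset.mem_filter.mp hS).1 (Finset.mem_filter.mp hT).1 hne
      simp only [id] at this
      rw [← this]
      simpa using Finset.card_le_univ ((𝓢.filter fun S => ¬ S.card ≤ s).biUnion id)
  have h2 := Finset.card_filter_add_card_filter_not (s := 𝓢) fun S => S.card ≤ s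
  have h1' : ((𝓢.filter fun S => ¬ S.card ≤ s).card : ℝ) * (s + 1) ≤ n := by exact_mod_cast h1
  have h2' : ((𝓢.filter fun S => S.card ≤ s).card : ℝ) +
    (𝓢.filter fun S => ¬ S.card ≤ s).card = 𝓢.card := by exact_mod_cast h2
  -- More than M disjoint sets with more than s nodes each would cover more than M · s ≥ n nodes.
  have h3 : ((𝓢.filter fun S => ¬ S.card ≤ s).card : ℝ) ≤ M := by
    by_contra hcon
    nlinarith [not_le.mp hcon, Nat.cast_nonneg (α := ℝ) s]
  linarith

open Classical in
/-- The tester for `P` that is obtained from the local test `A`. Here `C` is a constant for the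
number of samples, `K` is the ratio of the distance to `P` and the number of witnesses, and the
property `P` is trivial for graphs with less than `n₀` nodes. -/
noncomputable def tester (P : ∀ n : ℕ, SimpleGraph (Fin n) → Prop) (n₀ K : ℕ) (C : ℝ)
    (A : ∀ n : ℕ, ℝ → ℕ → Fin n → Algorithm n) (n : ℕ) (ε p d : ℝ) : Algorithm n :=
  if d ≤ 0 ∨ n ≤ 16 * K / (ε * d) then .readGraph (P n)
  else if n < n₀ then .answer (decide (∀ G, P n G))
  else if 2 * K < ε * d then .answer true
  else levelTester (A n d) (C * max 1 (-Real.log (1 - p))) (ε * d) (Nat.clog 2 ⌈4 * K / (ε * d)⌉₊)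

/-- Small witnesses cover enough nodes for random start nodes to hit them. The restriction `2 * t <
n` in `hfar` is harmless because graphs with n ≤ 16K/(εd) are read completely. -/
theorem hasTester_of_localTest (P : ∀ n : ℕ, SimpleGraph (Fin n) → Prop) {a : ℕ} (ha : 2 ≤ a)
    (n₀ K c : ℕ) {δ : ℝ} (hK : 1 ≤ K) (hδ : 0 < δ) (hδ1 : δ ≤ 1)
    (A : ∀ n : ℕ, ℝ → ℕ → Fin n → Algorithm n)
    (hsmall : ∀ (n : ℕ) [NeZero n], n < n₀ → (∀ G, P n G) ∨ ∀ G, ¬ P n G)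
    (hsound : ∀ (n : ℕ) [NeZero n] (G : SimpleGraph (Fin n)) (L : IncidenceLists G) (t : ℕ)
      (v : Fin n), P n G → (A n (avgDegree G) t v).acc L = 1)
    (hqueries : ∀ (n : ℕ) [NeZero n] (G : SimpleGraph (Fin n)) (L : IncidenceLists G) (t : ℕ)
      (v : Fin n), 1 ≤ t → (A n (avgDegree G) t v).queries L ≤ c * t ^ 2)
    (hfar : ∀ (n : ℕ) [NeZero n] (G : SimpleGraph (Fin n)) (ε : ℝ), 0 < ε → n₀ ≤ n →
      IsFar ε (P n) G → ∃ 𝓢 : Finset (Finset (Fin n)),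
        (𝓢 : Set (Finset (Fin n))).PairwiseDisjoint id ∧ (∀ S ∈ 𝓢, S.Nonempty) ∧
        ε * G.edgeSet.ncard ≤ K * 𝓢.card ∧
        ∀ S ∈ 𝓢, ∀ t : ℕ, S.card ≤ t → 2 * t < n → ∀ L : IncidenceLists G, ∀ v ∈ S,
          (A n (avgDegree G) t v).acc L ≤ 1 - δ) :
    HasTester P a := by
  classical
  have hK' : (1 : ℝ) ≤ K := by exact_mod_cast hK
  -- With at least xn/(4K) small witnesses, the exponent δCQ/(2xn) · xn/(4K) becomes exactly Q.
  set C : ℝ := 8 * K / δ with hC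
  have hC8 : 8 * (K : ℝ) ≤ C := by
    rw [hC, le_div_iff₀ hδ]
    nlinarith
  refine ⟨(16 * K) ^ (a - 2) * (512 * K ^ 2 + 32 * (1 + c) * C * K), tester P n₀ K C A, ?_⟩
  intro n _ ε p hε hp0 hp1 G L
  have hn : (0 : ℝ) < n := by exact_mod_cast Nat.pos_of_ne_zero (NeZero.ne n)
  have hn1 : (1 : ℝ) ≤ n := by exact_mod_cast Nat.pos_of_ne_zero (NeZero.ne n)
  set d := avgDegree G with hd
  set Q := max 1 (-Real.log (1 - p)) with hQ
  have hQ1 : 1 ≤ Q := le_max_left _ _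
  rw [Algorithm.run_true, Algorithm.run_false, ENNReal.ofReal_eq_one]
  suffices h : (P n G → (tester P n₀ K C A n ε p d).acc L = 1) ∧
      (IsFar ε (P n) G → (tester P n₀ K C A n ε p d).acc L ≤ 1 - p) ∧
      (0 < d → ∃ B : ℝ, 0 ≤ B ∧ B ≤ 512 * K ^ 2 + 32 * (1 + c) * C * K ∧ ε * d ≤ 16 * K ∧
        ((tester P n₀ K C A n ε p d).queries L : ℝ) ≤ B * Q / (ε * d) ^ 2 ∨
        (tester P n₀ K C A n ε p d).queries L = 0) by
    refine ⟨h.1, fun hf => ENNReal.ofReal_le_ofReal (by linarith [h.2.1 hf]), fun hd0 => ?_⟩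
    have hx : 0 < ε * d := mul_pos hε hd0
    have hC0 : 0 ≤ C := by linarith
    obtain ⟨B, ⟨hB0, hB, hxX, hq⟩ | hq⟩ := h.2.2 hd0
    · refine (queries_bound_of_sq ha hx hxX hB0 (by linarith)
        (le_max_left 1 (Real.log (1 / (ε * d)))) hq).trans ?_
      have : 0 < max 1 (Real.log (1 / (ε * d))) := lt_of_lt_of_le one_pos (le_max_left _ _)
      gcongr
    · rw [hq]
      have : 0 < max 1 (Real.log (1 / (ε * d))) := lt_of_lt_of_le one_pos (le_max_left _ _)
      have : 0 < Q := by linarith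
      simp only [Nat.cast_zero]
      positivity
  have hC0 : 0 ≤ C := by linarith
  unfold tester
  split_ifs with h1 h2 h3
  · have hr := Algorithm.reduces_readGraph L (P n)
    refine ⟨fun h => ?_, fun hf => ?_, fun hd0 => ⟨512 * K ^ 2, Or.inl ?_⟩⟩
    · rw [hr.1, decide_eq_true h]; simp [Algorithm.acc]
    · rw [hr.1, decide_eq_false fun h => not_isFar_of_prop hε h hf]
      simpa [Algorithm.acc] using hp1.le
    · have hx : 0 < ε * d := mul_pos hε hd0
      have h1 := h1.resolve_left hd0.not_ge
      rw [le_div_iff₀ hx] at h1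
      refine ⟨by positivity, by
        have : 0 ≤ 32 * (1 + c) * C * K := by positivity
        linarith, by nlinarith, ?_⟩
      have hq : ((Algorithm.readGraph (P n)).queries L : ℝ) ≤ n * (n + 1) := by
        exact_mod_cast hr.2.trans (by simp [Algorithm.queries])
      rw [le_div_iff₀ (by positivity)]
      -- Here n · εd ≤ 16K, so the at most 2n² queries are bounded by 512K²/(εd)².
      have h4 : (n * (ε * d)) ^ 2 ≤ (16 * K) ^ 2 := pow_le_pow_left₀ (by positivity) h1 2
      calc ((Algorithm.readGraph (P n)).queries L : ℝ) * (ε * d) ^ 2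
          ≤ (2 * n ^ 2) * (ε * d) ^ 2 :=
            mul_le_mul_of_nonneg_right (hq.trans (by nlinarith)) (by positivity)
        _ = 2 * (n * (ε * d)) ^ 2 := by ring
        _ ≤ 512 * K ^ 2 * 1 := by nlinarith
        _ ≤ _ := mul_le_mul_of_nonneg_left hQ1 (by positivity)
  · refine ⟨fun h => ?_, fun hf => ?_, fun _ => ⟨0, Or.inr rfl⟩⟩
    · have := (hsmall n h2).resolve_right fun h' => h' G h
      rw [decide_eq_true this]; simp [Algorithm.acc]
    · rw [decide_eq_false fun h => not_isFar_of_prop hε (h G) hf]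
      simpa [Algorithm.acc] using hp1.le
  · refine ⟨fun _ => by simp [Algorithm.acc], fun hf => ?_, fun _ => ⟨0, Or.inr rfl⟩⟩
    -- There are at most n disjoint nonempty witnesses, so ε|E| = εdn/2 ≤ Kn, contradicting 2K < εd.
    exfalso
    obtain ⟨𝓢, hdisj, hne, hcard, -⟩ := hfar n G ε hε (not_lt.mp h2) hf
    have h4 : 𝓢.card ≤ n := by
      have e := Finset.card_biUnion (s := 𝓢) (t := id) fun S hS T hT hne => hdisj hS hT hne
      have e2 : 𝓢.card * 1 ≤ ∑ S ∈ 𝓢, S.card := by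
        rw [← smul_eq_mul, ← Finset.sum_const]
        exact Finset.sum_le_sum fun S hS => (hne S hS).card_pos
      simp only [id] at e
      rw [← e] at e2
      have := Finset.card_le_univ (𝓢.biUnion id)
      simp only [Fintype.card_fin] at this
      simp only [mul_one] at e2
      exact e2.trans this
    have h4' : (𝓢.card : ℝ) ≤ n := by exact_mod_cast h4
    have h5 := mul_avgDegree G
    nlinarith
  · push Not at h1
    obtain ⟨hd0, h1⟩ := h1
    have hx : 0 < ε * d := mul_pos hε hd0
    set x := ε * d with hxdef
    have hx2 : x ≤ 2 * K := not_lt.mp h3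
    -- With M = xn/(4K) there are at least 2M witnesses and M · s = n, so at least M of them have
    -- size at most s.
    set s : ℝ := 4 * K / x with hs
    have hs2 : 2 ≤ s := by rw [hs, le_div_iff₀ hx]; linarith
    have hceil : 1 < ⌈s⌉₊ := Nat.lt_ceil.mpr (by push_cast; linarith)
    have hIs : s ≤ 2 ^ Nat.clog 2 ⌈s⌉₊ := by
      refine (Nat.le_ceil s).trans ?_
      exact_mod_cast Nat.le_pow_clog (by norm_num) _
    have hI2 : (2 : ℝ) ^ Nat.clog 2 ⌈s⌉₊ ≤ 2 * s := by
      have h4 := Nat.pow_pred_clog_lt_self (b := 2) (by norm_num) hceil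
      obtain ⟨j, hj⟩ := Nat.exists_eq_succ_of_ne_zero
        (Nat.clog_pos (b := 2) (by norm_num) hceil).ne'
      rw [hj] at h4 ⊢
      have h5 := Nat.lt_ceil.mp h4
      push_cast [Nat.pred_succ] at h5
      rw [pow_succ]
      linarith
    set I := Nat.clog 2 ⌈s⌉₊ with hI
    have hsx : s * x = 4 * K := by rw [hs]; field_simp
    refine ⟨fun h => ?_, fun hf => ?_, fun _ => ⟨32 * (1 + c) * C * K, Or.inl ⟨by positivity, ?_,
      by linarith, ?_⟩⟩⟩
    · exact acc_levelTester_of_sound L _ _ _ _ fun t v => hsound n G L t v h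
    · obtain ⟨𝓢, hdisj, hne, hcard, hrej⟩ := hfar n G ε hε (not_lt.mp h2) hf
      have h5 := mul_avgDegree G
      rw [← hd] at h5
      have h6 : 2 * (x * n / (4 * K)) ≤ 𝓢.card := by
        rw [← mul_div_assoc, div_le_iff₀ (by positivity)]
        have : x * n = 2 * (ε * G.edgeSet.ncard) := by rw [hxdef]; linear_combination ε * h5
        linarith
      have h7 := card_small_sets 𝓢 hdisj (s := 2 ^ I) (M := x * n / (4 * K)) (by positivity) h6 (by
        push_cast
        calc (n : ℝ) = x * n / (4 * K) * s := by rw [hs]; field_simp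
          _ ≤ _ := mul_le_mul_of_nonneg_left hIs (by positivity))
      have h8 := acc_levelTester_le L (A n d) (C := C * Q) (I := I) hx (by positivity) hδ.le
        (𝓢.filter fun S => S.card ≤ 2 ^ I)
        (hdisj.subset (Finset.coe_subset.mpr (Finset.filter_subset _ _)))
        (fun S hS => hne S (Finset.mem_filter.mp hS).1) (fun S hS => (Finset.mem_filter.mp hS).2)
        (fun S hS i hi hSi v hv => hrej S (Finset.mem_filter.mp hS).1 _ hSi (by
          -- The size bounds used are at most 2s, while n > 16K/x = 4s.
          have h9 : (2 : ℝ) ^ i ≤ 2 ^ I := pow_le_pow_right₀ (by norm_num) hi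
          have h10 : 16 * K / x = 4 * s := by rw [hs]; ring
          have h11 : (2 * 2 ^ i : ℝ) < n := by linarith
          exact_mod_cast h11) L v hv)
      refine h8.trans ((Real.exp_le_exp.mpr (neg_le_neg ?_)).trans (exp_neg_max_le hp1))
      rw [le_div_iff₀ (by positivity)]
      have h12 : δ * C = 8 * K := by rw [hC]; field_simp
      calc max 1 (-Real.log (1 - p)) * (2 * x * n) = 8 * K * Q * (x * n / (4 * K)) := by
            rw [hQ]; field_simp; ring
        _ ≤ 8 * K * Q * (𝓢.filter fun S => S.card ≤ 2 ^ I).card :=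
            mul_le_mul_of_nonneg_left h7 (by positivity)
        _ = _ := by rw [← h12]; ring
    · have : 0 ≤ 512 * (K : ℝ) ^ 2 := by positivity
      linarith
    · refine (queries_levelTester_le L (A n d) (c := c) hx ?_ fun i v =>
        hqueries n G L _ v Nat.one_le_two_pow).trans ?_
      · calc (2 : ℝ) ^ I * x ≤ 2 * s * x := mul_le_mul_of_nonneg_right hI2 hx.le
          _ = 8 * K := by rw [mul_assoc, hsx]; ring
          _ ≤ C * 1 := by linarith
          _ ≤ C * Q := mul_le_mul_of_nonneg_left hQ1 hC0
      · rw [div_le_div_iff₀ hx (by positivity)]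
        calc 4 * (1 + c) * (C * Q) * 2 ^ I * x ^ 2
            ≤ 4 * (1 + c) * (C * Q) * (2 * s) * x ^ 2 := by gcongr
          _ = 8 * (1 + c) * (C * Q) * (s * x) * x := by ring
          _ = _ := by rw [hsx]; ring

/-! ### Unit-capacity flows and saturated cuts -/

section Flow

variable {V : Type*} [Fintype V] [DecidableEq V] {G : SimpleGraph V}

open Classical in
/-- The number of edges that leave `S`. -/
noncomputable def cutSize (G : SimpleGraph V) (S : Finset V) : ℕ :=
  ∑ x ∈ S, (Sᶜ.filter (G.Adj x)).card

/-- An integral flow in `G` with unit capacities. -/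
structure IsFlow (G : SimpleGraph V) (f : V → V → ℤ) : Prop where
  antisymm : ∀ a b, f a b = -f b a
  le_one : ∀ a b, f a b ≤ 1
  nonpos : ∀ a b, ¬ G.Adj a b → f a b ≤ 0

/-- The net flow that leaves the node `x`. -/
def netFlow (f : V → V → ℤ) (x : V) : ℤ := ∑ y, f x y

omit [Fintype V] [DecidableEq V] in
lemma IsFlow.zero : IsFlow G fun _ _ => 0 := ⟨by simp, by simp, by simp⟩

/-- Flow between two nodes of S cancels by antisymmetry. -/
lemma IsFlow.sum_netFlow {f : V → V → ℤ} (hf : IsFlow G f) (S : Finset V) :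
    ∑ x ∈ S, netFlow f x = ∑ x ∈ S, ∑ y ∈ Sᶜ, f x y := by
  have h1 : ∑ x ∈ S, ∑ y ∈ S, f x y = 0 := by
    have h2 : ∑ x ∈ S, ∑ y ∈ S, f x y = -∑ x ∈ S, ∑ y ∈ S, f x y := by
      conv_lhs => rw [Finset.sum_comm]
      rw [← Finset.sum_neg_distrib]
      refine Finset.sum_congr rfl fun x _ => ?_
      rw [← Finset.sum_neg_distrib]
      exact Finset.sum_congr rfl fun y _ => hf.antisymm y x
    omega
  have h3 : ∀ x, netFlow f x = ∑ y ∈ S, f x y + ∑ y ∈ Sᶜ, f x y := fun x =>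
    (Finset.sum_add_sum_compl S (f x)).symm
  simp_rw [h3, Finset.sum_add_distrib, h1, zero_add]

open Classical in
lemma cutSize_eq_sum (G : SimpleGraph V) (S : Finset V) :
    (cutSize G S : ℤ) = ∑ x ∈ S, ∑ y ∈ Sᶜ, if G.Adj x y then 1 else 0 := by
  simp [cutSize]

omit [Fintype V] [DecidableEq V] in
lemma IsFlow.le_ite {f : V → V → ℤ} (hf : IsFlow G f) (a b : V) [Decidable (G.Adj a b)] :
    f a b ≤ if G.Adj a b then 1 else 0 := by
  split_ifs with h
  · exact hf.le_one a b
  · exact hf.nonpos a b h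

lemma IsFlow.sum_netFlow_le {f : V → V → ℤ} (hf : IsFlow G f) (S : Finset V) :
    ∑ x ∈ S, netFlow f x ≤ cutSize G S := by
  classical
  rw [hf.sum_netFlow, cutSize_eq_sum]
  exact Finset.sum_le_sum fun x _ => Finset.sum_le_sum fun y _ => hf.le_ite x y

/-- If the flow uses all the edges that leave `S`, then nothing can be pushed out of `S`. -/
def Saturated (G : SimpleGraph V) (f : V → V → ℤ) (S : Finset V) : Prop :=
  ∀ x ∈ S, ∀ y ∉ S, G.Adj x y → 1 ≤ f x y

/-- The net flow out of S is a termwise bounded sum; if it attains its bound, every term does. -/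
lemma IsFlow.saturated {f : V → V → ℤ} (hf : IsFlow G f) {S : Finset V}
    (h : (cutSize G S : ℤ) ≤ ∑ x ∈ S, netFlow f x) : Saturated G f S := by
  classical
  intro x hx y hy hxy
  have h1 := le_antisymm h (hf.sum_netFlow_le S)
  rw [hf.sum_netFlow, cutSize_eq_sum] at h1
  have h2 := (Finset.sum_eq_sum_iff_of_le fun x _ =>
    Finset.sum_le_sum fun y (_ : y ∈ Sᶜ) => hf.le_ite x y).mp h1.symm x hx
  have h3 := (Finset.sum_eq_sum_iff_of_le fun y _ => hf.le_ite x y).mp h2 y (by simpa using hy)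
  simp [h3, hxy]

lemma Saturated.cutSize_le {f : V → V → ℤ} {S : Finset V} (h : Saturated G f S)
    (hf : IsFlow G f) : (cutSize G S : ℤ) ≤ ∑ x ∈ S, netFlow f x := by
  classical
  rw [hf.sum_netFlow, cutSize_eq_sum]
  refine Finset.sum_le_sum fun x hx => Finset.sum_le_sum fun y hy => ?_
  by_cases hxy : G.Adj x y
  · simpa [hxy] using h x hx y (by simpa using hy) hxy
  · simp only [hxy, if_false]
    rw [hf.antisymm]
    have := hf.nonpos y x fun h => hxy h.symm
    omega

/-- Push one more unit of flow along the arc from `p` to `u`. -/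
def addArc (f : V → V → ℤ) (p u : V) : V → V → ℤ := fun a b =>
  f a b + (if a = p ∧ b = u then 1 else 0) - (if a = u ∧ b = p then 1 else 0)

-- The condition `f p u < 1` is residual capacity: the edge is unused, or it carries a unit from u
-- to p, which is then cancelled.
omit [Fintype V] in
lemma IsFlow.addArc {f : V → V → ℤ} (hf : IsFlow G f) {p u : V} (hpu : G.Adj p u)
    (h : f p u < 1) : IsFlow G (addArc f p u) := by
  have hne := hpu.ne
  refine ⟨fun a b => ?_, fun a b => ?_, fun a b hab => ?_⟩
  · simp only [SparseGraphTesting.addArc, hf.antisymm a b, and_comm (a := b = _)]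
    ring
  · have := hf.le_one a b
    simp only [SparseGraphTesting.addArc]
    split_ifs with h1 h2
    all_goals try omega
    obtain ⟨rfl, rfl⟩ := h1
    omega
  · have := hf.nonpos a b hab
    simp only [SparseGraphTesting.addArc]
    split_ifs with h1 h2
    all_goals try omega
    obtain ⟨rfl, rfl⟩ := h1
    exact absurd hpu hab

lemma netFlow_addArc (f : V → V → ℤ) (p u x : V) : netFlow (addArc f p u) x =
    netFlow f x + (if x = p then 1 else 0) - (if x = u then 1 else 0) := by
  have h : ∀ q r : V, (∑ y, if x = q ∧ y = r then (1 : ℤ) else 0) = if x = q then 1 else 0 := by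
    intro q r
    by_cases hq : x = q <;> simp [hq]
  simp only [netFlow, addArc, Finset.sum_sub_distrib, Finset.sum_add_distrib, h]

/-- `g` is a flow that is obtained from `f` by sending one more unit from `v` to `x`. -/
structure IsAugmentation (G : SimpleGraph V) (f : V → V → ℤ) (v x : V) (g : V → V → ℤ) :
    Prop where
  isFlow : IsFlow G g
  netFlow_eq : ∀ y, netFlow g y = netFlow f y + (if y = v then 1 else 0) - (if y = x then 1 else 0)

lemma IsAugmentation.addArc {f g : V → V → ℤ} {v p u : V} (h : IsAugmentation G f v p g)
    (hpu : G.Adj p u) (hlt : g p u < 1) : IsAugmentation G f v u (addArc g p u) := by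
  refine ⟨h.isFlow.addArc hpu hlt, fun y => ?_⟩
  rw [netFlow_addArc, h.netFlow_eq]
  ring

lemma IsAugmentation.sum_netFlow {f g : V → V → ℤ} {v x : V} (h : IsAugmentation G f v x g)
    {S : Finset V} (hv : v ∈ S) (hx : x ∉ S) :
    ∑ y ∈ S, netFlow g y = ∑ y ∈ S, netFlow f y + 1 := by
  simp [h.netFlow_eq, Finset.sum_add_distrib, Finset.sum_sub_distrib, hv, hx]

end Flow

/-! ### Local search in the residual graph -/

/-- The state of a local search: the visited nodes, their neighbourhoods and, for each visited
node, a flow that sends one more unit there. -/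
structure SearchState (n : ℕ) where
  visited : Finset (Fin n)
  nbrs : Fin n → Finset (Fin n)
  flow : Fin n → Fin n → Fin n → ℤ

/-- The outcome of a local search: no further node can be reached, or a node of high degree has
been reached, or the bound on the number of visited nodes has been reached. -/
inductive SearchOutcome (n : ℕ)
  | closed (st : SearchState n)
  | high (g : Fin n → Fin n → ℤ)
  | full (st : SearchState n)

open Classical in
/-- Search for the nodes that can be reached in the residual graph of the flow `f`. -/
noncomputable def search {n : ℕ} (f : Fin n → Fin n → ℤ) (D : ℕ)
    (next : SearchOutcome n → Algorithm n) : ℕ → SearchState n → Algorithm n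
  | 0, st => next (.full st)
  | m + 1, st =>
    if h : ∃ e : Fin n × Fin n, e.1 ∈ st.visited ∧ e.2 ∈ st.nbrs e.1 ∧ e.2 ∉ st.visited ∧
        f e.1 e.2 < 1 then
      let p := h.choose.1
      let u := h.choose.2
      .readVertex u D (next (.high (addArc (st.flow p) p u))) fun s => search f D next m
        ⟨insert u st.visited, Function.update st.nbrs u s,
          Function.update st.flow u (addArc (st.flow p) p u)⟩
    else next (.closed st)

section search

variable {n : ℕ} {G : SimpleGraph (Fin n)}

/-- The invariant of a local search from `v`. -/
structure SearchState.Valid (L : IncidenceLists G) (f : Fin n → Fin n → ℤ) (v : Fin n)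
    (st : SearchState n) : Prop where
  mem : v ∈ st.visited
  nbrs_eq : ∀ p ∈ st.visited, st.nbrs p = L.nbrs p
  isAugmentation : ∀ p ∈ st.visited, IsAugmentation G f v p (st.flow p)
  flow_eq : ∀ p ∈ st.visited, ∀ a, ∀ b ∉ st.visited, st.flow p a b = f a b
  subset : ∀ S : Finset (Fin n), v ∈ S → Saturated G f S → st.visited ⊆ S

/-- The specification of the outcome of a local search. -/
def SearchOutcome.Valid (L : IncidenceLists G) (f : Fin n → Fin n → ℤ) (D M : ℕ) (v : Fin n) :
    SearchOutcome n → Prop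
  | .closed st => st.Valid L f v ∧ st.visited.card < M ∧ Saturated G f st.visited
  | .high g => ∃ x, D < (L.nbrs x).card ∧ IsAugmentation G f v x g ∧
      ∀ S : Finset (Fin n), v ∈ S → Saturated G f S → x ∈ S
  | .full st => st.Valid L f v ∧ st.visited.card = M

/-- By `flow_eq`, the flow stored for p agrees with f on arcs into unvisited nodes, so the arc to u
still has room. A saturated set that contains p must contain u, since `f p u < 1`. -/
lemma SearchState.Valid.insert {L : IncidenceLists G} {f : Fin n → Fin n → ℤ} {v p u : Fin n}
    {st : SearchState n} (h : st.Valid L f v) (hp : p ∈ st.visited) (hpu : G.Adj p u)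
    (hu : u ∉ st.visited) (hf : f p u < 1) :
    IsAugmentation G f v u (addArc (st.flow p) p u) ∧
    SearchState.Valid L f v ⟨Insert.insert u st.visited, Function.update st.nbrs u (L.nbrs u),
      Function.update st.flow u (addArc (st.flow p) p u)⟩ := by
  have hne : ∀ q ∈ st.visited, q ≠ u := fun q hq h => hu (h ▸ hq)
  have haug : IsAugmentation G f v u (addArc (st.flow p) p u) :=
    (h.isAugmentation p hp).addArc hpu (by rwa [h.flow_eq p hp p u hu])
  refine ⟨haug, Finset.mem_insert_of_mem h.mem, fun q hq => ?_, fun q hq => ?_,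
    fun q hq a b hb => ?_, fun S hv hS => Finset.insert_subset ?_ (h.subset S hv hS)⟩
  · rcases Finset.mem_insert.mp hq with rfl | hq
    · simp
    · simpa [Function.update_of_ne (hne q hq)] using h.nbrs_eq q hq
  · rcases Finset.mem_insert.mp hq with rfl | hq
    · simpa using haug
    · simpa [Function.update_of_ne (hne q hq)] using h.isAugmentation q hq
  · simp only [Finset.mem_insert, not_or] at hb
    have hbp : b ≠ p := fun e => hb.2 (e ▸ hp)
    rcases Finset.mem_insert.mp hq with rfl | hq
    · simpa [addArc, hb.1, hbp] using h.flow_eq p hp a b hb.2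
    · simpa [Function.update_of_ne (hne q hq)] using h.flow_eq q hq a b hb.2
  · by_contra huS
    have := hS p (h.subset S hv hS hp) u huS hpu
    omega

/-- On a fixed input the search draws no samples and ends in one definite outcome. The arbitrary
choice of the next arc does not matter, as only the invariant is used. -/
lemma exists_reduces_search (L : IncidenceLists G) {f : Fin n → Fin n → ℤ} {D M m : ℕ} {v : Fin n}
    (next : SearchOutcome n → Algorithm n) {st : SearchState n} (h : st.Valid L f v)
    (hM : st.visited.card + m = M) :
    ∃ o : SearchOutcome n, o.Valid L f D M v ∧
      Algorithm.Reduces L (m * (D + 1)) (search f D next m st) (next o) := by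
  induction m generalizing st with
  | zero => exact ⟨.full st, ⟨h, hM⟩, by simpa [search] using Algorithm.Reduces.refl L _⟩
  | succ m ih =>
    rw [search]
    split_ifs with he
    · obtain ⟨hp, hpu, hu, hf⟩ := he.choose_spec
      set p := he.choose.1
      set u := he.choose.2
      rw [h.nbrs_eq p hp, L.mem_nbrs] at hpu
      obtain ⟨haug, hst⟩ := h.insert hp hpu hu hf
      rcases Nat.lt_or_ge D (L.nbrs u).card with hD | hD
      · refine ⟨.high _, ⟨u, hD, haug, fun S hv hS => hst.subset S hv hS (by simp)⟩,
          (Algorithm.reduces_readVertex_high L _ _ hD).mono ?_⟩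
        nlinarith
      · obtain ⟨o, ho, hr⟩ := ih hst (by rw [Finset.card_insert_of_notMem hu]; omega)
        refine ⟨o, ho, ((Algorithm.reduces_readVertex L _ _ hD).trans hr).mono ?_⟩
        exact le_of_eq (by ring)
    · refine ⟨.closed st, ⟨h, by omega, fun x hx y hy hxy => ?_⟩,
        (Algorithm.Reduces.refl L _).mono (Nat.zero_le _)⟩
      by_contra hlt
      exact he ⟨(x, y), hx, by simpa [h.nbrs_eq x hx] using hxy, hy, by simpa using hlt⟩

/-- A local search that starts in `v` and visits up to `2 * t + 1` nodes. -/
noncomputable def searchFrom (v : Fin n) (f : Fin n → Fin n → ℤ) (D t : ℕ)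
    (next : SearchOutcome n → Algorithm n) : Algorithm n :=
  .readVertex v D (.answer true) fun s =>
    search f D next (2 * t) ⟨{v}, fun _ => s, fun _ => f⟩

lemma exists_reduces_searchFrom (L : IncidenceLists G) {f : Fin n → Fin n → ℤ} (hf : IsFlow G f)
    {D t : ℕ} {v : Fin n} (hv : (L.nbrs v).card ≤ D) (next : SearchOutcome n → Algorithm n) :
    ∃ o : SearchOutcome n, o.Valid L f D (2 * t + 1) v ∧
      Algorithm.Reduces L ((2 * t + 1) * (D + 1)) (searchFrom v f D t next) (next o) := by
  obtain ⟨o, ho, hr⟩ := exists_reduces_search L (D := D) (f := f) (v := v) (m := 2 * t)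
    (M := 2 * t + 1) next
    (st := ⟨{v}, fun _ => L.nbrs v, fun _ => f⟩)
    ⟨by simp, by simp, fun p hp => ⟨hf, fun y => by simp at hp; simp [hp]⟩, by simp,
      fun S hv _ => by simpa using hv⟩
    (by simp; ring)
  exact ⟨o, ho, ((Algorithm.reduces_readVertex L _ _ hv).trans hr).mono (le_of_eq (by ring))⟩

lemma searchFrom_high (L : IncidenceLists G) {f : Fin n → Fin n → ℤ}
    {D t : ℕ} {v : Fin n} (hv : D < (L.nbrs v).card) (next : SearchOutcome n → Algorithm n) :
    Algorithm.Reduces L ((2 * t + 1) * (D + 1)) (searchFrom v f D t next) (.answer true) :=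
  (Algorithm.reduces_readVertex_high L _ _ hv).mono (by nlinarith)

end search

/-! ### Randomized detection of small cuts -/

section cutTest

variable {n : ℕ} {G : SimpleGraph (Fin n)}

/-- An element of `P` that is selected by the node `y`. If `y` is uniformly distributed, then so
is the selected element, up to rounding. -/
noncomputable def pick (P : Finset (Fin n)) (y : Fin n) : Fin n :=
  P.toList.getD (y % P.card) y

lemma pick_mem {P : Finset (Fin n)} (hP : P.Nonempty) (y : Fin n) : pick P y ∈ P := by
  have h : (y : ℕ) % P.card < P.toList.length := by
    rw [Finset.length_toList]
    exact Nat.mod_lt _ hP.card_pos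
  rw [pick, List.getD_eq_getElem _ _ h, ← Finset.mem_toList]
  exact List.getElem_mem h

/-- The element with index a is selected by every node a + |P|q with q < ⌊n/|P|⌋. -/
lemma card_mul_le_card_pick {P T : Finset (Fin n)} (hT : T ⊆ P) :
    T.card * (n / P.card) ≤ (Finset.univ.filter fun y => pick P y ∈ T).card := by
  classical
  have hlt : ∀ x ∈ T, P.toList.idxOf x < P.card := fun x hx => by
    rw [← Finset.length_toList, List.idxOf_lt_length_iff, Finset.mem_toList]
    exact hT hx
  have hlt' : ∀ x ∈ T, ∀ q < n / P.card, P.toList.idxOf x + P.card * q < n := by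
    intro x hx q hq
    have h1 := hlt x hx
    have h2 : P.card * (q + 1) ≤ P.card * (n / P.card) := Nat.mul_le_mul_left _ hq
    have h3 := Nat.mul_div_le n P.card
    rw [mul_add] at h2
    omega
  rw [← Finset.card_range (n / P.card), ← Finset.card_product]
  have hmem : ∀ e ∈ T ×ˢ Finset.range (n / P.card), e.1 ∈ T ∧ e.2 < n / P.card := fun e he => by
    simpa using he
  refine Finset.card_le_card_of_injOn
    (fun e => if h : P.toList.idxOf e.1 + P.card * e.2 < n then
      (⟨P.toList.idxOf e.1 + P.card * e.2, h⟩ : Fin n) else e.1) ?_ ?_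
  · intro e he
    obtain ⟨h1, h2⟩ := hmem e he
    have h3 := hlt _ h1
    have h4 : P.toList.idxOf e.1 < P.toList.length := by rwa [Finset.length_toList]
    have h5 : pick P ⟨_, hlt' _ h1 _ h2⟩ = e.1 := by
      simp only [pick, Nat.add_mul_mod_self_left, Nat.mod_eq_of_lt h3]
      rw [List.getD_eq_getElem _ _ h4, List.getElem_idxOf]
    simp [hlt' _ h1 _ h2, h5, h1]
  · intro e he e' he' h
    obtain ⟨h1, h2⟩ := hmem e he
    obtain ⟨h1', h2'⟩ := hmem e' he'
    have h3 := hlt _ h1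
    have h3' := hlt _ h1'
    simp only [hlt' _ h1 _ h2, hlt' _ h1' _ h2', dite_true, Fin.mk.injEq] at h
    have h5 := congrArg (· % P.card) h
    have h6 := congrArg (· / P.card) h
    have hpos : 0 < P.card := by omega
    simp only [Nat.add_mul_mod_self_left, Nat.mod_eq_of_lt h3, Nat.mod_eq_of_lt h3'] at h5
    simp only [Nat.add_mul_div_left _ _ hpos, Nat.div_eq_of_lt h3, Nat.div_eq_of_lt h3',
      zero_add] at h6
    exact Prod.ext ((List.idxOf_inj (by rw [Finset.mem_toList]; exact hT h1)).mp h5) h6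

open Classical in
/-- If the search has found a set that is left by less than `k` edges, reject. Otherwise proceed
with a flow to a node of high degree or to a random visited node. -/
noncomputable def cutStep (k : ℕ) (next : (Fin n → Fin n → ℤ) → Algorithm n) :
    SearchOutcome n → Algorithm n
  | .closed st => .answer (decide
      (st.visited = Finset.univ ∨ k ≤ ∑ p ∈ st.visited, (st.nbrs p \ st.visited).card))
  | .high g => next g
  | .full st => .sample fun y => next (st.flow (pick st.visited y))

/-- Search for a set that contains `v` and is left by less than `k` edges, with up to `r`
augmentations of the flow `f`. -/
noncomputable def cutTest (k D t : ℕ) (v : Fin n) : ℕ → (Fin n → Fin n → ℤ) → Algorithm n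
  | 0, f => searchFrom v f D t (cutStep k fun _ => .answer true)
  | r + 1, f => searchFrom v f D t (cutStep k (cutTest k D t v r))

lemma SearchState.Valid.sum_eq_cutSize {L : IncidenceLists G} {f : Fin n → Fin n → ℤ} {v : Fin n}
    {st : SearchState n} (h : st.Valid L f v) :
    ∑ p ∈ st.visited, (st.nbrs p \ st.visited).card = cutSize G st.visited := by
  classical
  refine Finset.sum_congr rfl fun p hp => congrArg _ ?_
  ext w
  simp [h.nbrs_eq p hp, and_comm]

lemma SearchState.Valid.isFlow_pick {L : IncidenceLists G} {f : Fin n → Fin n → ℤ} {v : Fin n}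
    {st : SearchState n} (h : st.Valid L f v) (y : Fin n) :
    IsFlow G (st.flow (pick st.visited y)) :=
  (h.isAugmentation _ (pick_mem ⟨v, h.mem⟩ y)).isFlow

/-- Rejection requires that the edges of an actual nontrivial cut have been counted, which makes the
error one-sided. -/
lemma acc_cutStep_of_sound [NeZero n] (L : IncidenceLists G) {f : Fin n → Fin n → ℤ} {k D M : ℕ}
    {v : Fin n} (hG : ∀ S : Finset (Fin n), S.Nonempty → S ≠ Finset.univ → k ≤ cutSize G S)
    {next : (Fin n → Fin n → ℤ) → Algorithm n} (hnext : ∀ g, IsFlow G g → (next g).acc L = 1)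
    {o : SearchOutcome n} (ho : o.Valid L f D M v) : (cutStep k next o).acc L = 1 := by
  cases o with
  | closed st =>
    have h1 : st.visited = Finset.univ ∨
        k ≤ ∑ p ∈ st.visited, (st.nbrs p \ st.visited).card := by
      rw [ho.1.sum_eq_cutSize, or_iff_not_imp_left]
      exact hG _ ⟨v, ho.1.mem⟩
    simp [cutStep, h1, Algorithm.acc]
  | high g =>
    obtain ⟨x, -, h, -⟩ := ho
    exact hnext g h.isFlow
  | full st => exact Algorithm.acc_sample_eq_one L _ fun y => hnext _ (ho.1.isFlow_pick y)

lemma acc_searchFrom_of_forall (L : IncidenceLists G) {f : Fin n → Fin n → ℤ} (hf : IsFlow G f)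
    {D t : ℕ} {v : Fin n} {next : SearchOutcome n → Algorithm n}
    (h : ∀ o : SearchOutcome n, o.Valid L f D (2 * t + 1) v → (next o).acc L = 1) :
    (searchFrom v f D t next).acc L = 1 := by
  rcases Nat.lt_or_ge D (L.nbrs v).card with hD | hD
  · rw [(searchFrom_high L hD next).1]
    simp [Algorithm.acc]
  · obtain ⟨o, ho, hr⟩ := exists_reduces_searchFrom L hf hD next
    rw [hr.1, h o ho]

lemma queries_searchFrom_le (L : IncidenceLists G) {f : Fin n → Fin n → ℤ} (hf : IsFlow G f)
    {D t B : ℕ} {v : Fin n} {next : SearchOutcome n → Algorithm n}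
    (h : ∀ o : SearchOutcome n, o.Valid L f D (2 * t + 1) v → (next o).queries L ≤ B) :
    (searchFrom v f D t next).queries L ≤ (2 * t + 1) * (D + 1) + B := by
  rcases Nat.lt_or_ge D (L.nbrs v).card with hD | hD
  · refine (searchFrom_high L hD next).2.trans ?_
    simp [Algorithm.queries]
  · obtain ⟨o, ho, hr⟩ := exists_reduces_searchFrom L hf hD next
    exact hr.2.trans (Nat.add_le_add_left (h o ho) _)

lemma acc_cutTest_of_sound [NeZero n] (L : IncidenceLists G) {f : Fin n → Fin n → ℤ}
    (hf : IsFlow G f) {k D t : ℕ} {v : Fin n} (r : ℕ)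
    (hG : ∀ S : Finset (Fin n), S.Nonempty → S ≠ Finset.univ → k ≤ cutSize G S) :
    (cutTest k D t v r f).acc L = 1 := by
  induction r generalizing f with
  | zero =>
    exact acc_searchFrom_of_forall L hf fun o ho =>
      acc_cutStep_of_sound L hG (fun _ _ => by simp [Algorithm.acc]) ho
  | succ r ih =>
    exact acc_searchFrom_of_forall L hf fun o ho => acc_cutStep_of_sound L hG (fun g hg => ih hg) ho

lemma queries_cutStep_le (L : IncidenceLists G) {f : Fin n → Fin n → ℤ} {k D M B : ℕ}
    {v : Fin n} {next : (Fin n → Fin n → ℤ) → Algorithm n}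
    (hnext : ∀ g, IsFlow G g → (next g).queries L ≤ B)
    {o : SearchOutcome n} (ho : o.Valid L f D M v) : (cutStep k next o).queries L ≤ 1 + B := by
  cases o with
  | closed st => simp [cutStep, Algorithm.queries]
  | high g =>
    obtain ⟨x, -, h, -⟩ := ho
    exact (hnext g h.isFlow).trans (Nat.le_add_left _ _)
  | full st =>
    exact Nat.add_le_add_left (Finset.sup_le fun y _ => hnext _ (ho.1.isFlow_pick y)) 1

lemma queries_cutTest_le (L : IncidenceLists G) {f : Fin n → Fin n → ℤ} (hf : IsFlow G f)
    {k D t : ℕ} {v : Fin n} (r : ℕ) :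
    (cutTest k D t v r f).queries L ≤ (r + 1) * ((2 * t + 1) * (D + 1) + 1) := by
  induction r generalizing f with
  | zero =>
    refine (queries_searchFrom_le L hf fun o ho => queries_cutStep_le L (B := 0)
      (fun _ _ => by simp [Algorithm.queries]) ho).trans (le_of_eq (by ring))
  | succ r ih =>
    exact (queries_searchFrom_le L hf fun o ho => queries_cutStep_le L
      (fun g hg => ih hg) ho).trans (le_of_eq (by ring))

/-- Justifies the degree threshold t + k: a node above it cannot lie in the set sought, so its list
need not be read. -/
lemma card_nbrs_le_add_cutSize (L : IncidenceLists G) {S : Finset (Fin n)} {x : Fin n}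
    (hx : x ∈ S) : (L.nbrs x).card ≤ S.card + cutSize G S := by
  classical
  have h1 : L.nbrs x ⊆ S ∪ Sᶜ.filter (G.Adj x) := fun w hw => by
    have := (L.mem_nbrs x w).mp hw
    by_cases h : w ∈ S <;> simp [h, this]
  refine (Finset.card_le_card h1).trans ((Finset.card_union_le _ _).trans ?_)
  have h2 := Finset.single_le_sum (f := fun x => (Sᶜ.filter (G.Adj x)).card)
    (fun _ _ => Nat.zero_le _) hx
  have h3 : cutSize G S = ∑ x ∈ S, (Sᶜ.filter (G.Adj x)).card := by
    rw [cutSize]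
  rw [h3]
  exact Nat.add_le_add_left h2 _

/-- The flow `f` sends `j` units out of `S`, all of them from the node `v`. -/
structure SendsOut (G : SimpleGraph (Fin n)) (f : Fin n → Fin n → ℤ) (v : Fin n)
    (S : Finset (Fin n)) (j : ℕ) : Prop where
  isFlow : IsFlow G f
  le : netFlow f v ≤ j
  nonpos : ∀ u ≠ v, netFlow f u ≤ 0
  sum_eq : ∑ u ∈ S, netFlow f u = j

lemma SendsOut.augment {f g : Fin n → Fin n → ℤ} {v x : Fin n} {S : Finset (Fin n)} {j : ℕ}
    (h : SendsOut G f v S j) (hv : v ∈ S) (hx : x ∉ S) (hg : IsAugmentation G f v x g) :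
    SendsOut G g v S (j + 1) := by
  refine ⟨hg.isFlow, ?_, fun u hu => ?_, ?_⟩
  · have := h.le
    rw [hg.netFlow_eq]
    split_ifs <;> push_cast <;> omega
  · have := h.nonpos u hu
    rw [hg.netFlow_eq]
    split_ifs <;> omega
  · rw [hg.sum_netFlow hv hx, h.sum_eq]
    push_cast; rfl

/-- Only v is a source, of at most j units. Hence any saturated set has a small cut, even if it is
not S and some units end inside it. -/
lemma SendsOut.cutSize_le {f : Fin n → Fin n → ℤ} {v : Fin n} {S P : Finset (Fin n)} {j : ℕ}
    (h : SendsOut G f v S j) (hP : Saturated G f P) : cutSize G P ≤ j := by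
  classical
  have h1 := hP.cutSize_le h.isFlow
  have h2 : ∑ x ∈ P, netFlow f x ≤ ∑ x ∈ P, if x = v then (j : ℤ) else 0 :=
    Finset.sum_le_sum fun x _ => by
      split_ifs with hx
      · exact hx ▸ h.le
      · exact h.nonpos x hx
  rw [Finset.sum_ite_eq' P v] at h2
  split_ifs at h2 <;> omega

lemma acc_cutStep_closed (L : IncidenceLists G) {f : Fin n → Fin n → ℤ} {k M j : ℕ}
    {v : Fin n} {S : Finset (Fin n)} (next : (Fin n → Fin n → ℤ) → Algorithm n)
    (hj : j < k) (hM : M ≤ n) (h : SendsOut G f v S j) {st : SearchState n}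
    (hst : st.Valid L f v) (hcard : st.visited.card < M) (hsat : Saturated G f st.visited) :
    (cutStep k next (.closed st)).acc L = 0 := by
  have h1 : ¬ (st.visited = Finset.univ ∨
      k ≤ ∑ p ∈ st.visited, (st.nbrs p \ st.visited).card) := by
    rw [hst.sum_eq_cutSize, not_or]
    refine ⟨fun h => ?_, not_le.mpr ((h.cutSize_le hsat).trans_lt hj)⟩
    rw [h, Finset.card_univ, Fintype.card_fin] at hcard
    omega
  simp [cutStep, h1, Algorithm.acc]

/-- Induction on the number r of augmentations left. For r = 0 the cut of S has at most j edges, so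
S is saturated; the search cannot leave S, and as |S| ≤ t it closes before reaching 2t + 1 nodes.
Each earlier unit leaves S with probability at least 1/4, or a rejecting cut is found at once. -/
lemma acc_cutTest_le [NeZero n] (L : IncidenceLists G) {f : Fin n → Fin n → ℤ} {k t j r : ℕ}
    {v : Fin n} {S : Finset (Fin n)} (hv : v ∈ S) (hS : S.card ≤ t) (hcut : cutSize G S < k)
    (ht : 2 * t < n) (hf : SendsOut G f v S j) (hjr : j + r + 1 = k) :
    (cutTest k (t + k) t v r f).acc L ≤ 1 - (1 / 4) ^ r := by
  classical
  have hdeg : ∀ x ∈ S, (L.nbrs x).card ≤ t + k := fun x hx =>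
    (card_nbrs_le_add_cutSize L hx).trans (by omega)
  induction r generalizing f j with
  | zero =>
    obtain ⟨o, ho, hr⟩ := exists_reduces_searchFrom L hf.isFlow (t := t) (hdeg v hv)
      (cutStep k fun _ => .answer true)
    rw [cutTest, hr.1]
    have hsat : Saturated G f S := hf.isFlow.saturated (by rw [hf.sum_eq]; omega)
    cases o with
    | closed st =>
      rw [acc_cutStep_closed L _ (by omega) (by omega) hf ho.1 ho.2.1 ho.2.2]
      norm_num
    | high g =>
      obtain ⟨x, hx, -, h⟩ := ho
      exact absurd hx (hdeg x (h S hv hsat)).not_gt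
    | full st =>
      have h1 := Finset.card_le_card (ho.1.subset S hv hsat)
      have := ho.2
      omega
  | succ r ih =>
    obtain ⟨o, ho, hr⟩ := exists_reduces_searchFrom L hf.isFlow (t := t) (hdeg v hv)
      (cutStep k (cutTest k (t + k) t v r))
    rw [cutTest, hr.1]
    have hpow : (0 : ℝ) ≤ (1 / 4) ^ r := by positivity
    have hstep : ∀ x ∉ S, ∀ g, IsAugmentation G f v x g →
        (cutTest k (t + k) t v r g).acc L ≤ 1 - (1 / 4) ^ r := fun x hx g hg =>
      ih (hf.augment hv hx hg) (by omega)
    cases o with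
    | closed st =>
      rw [acc_cutStep_closed L _ (by omega) (by omega) hf ho.1 ho.2.1 ho.2.2]
      have : (1 / 4 : ℝ) ^ (r + 1) ≤ 1 := pow_le_one₀ (by norm_num) (by norm_num)
      linarith
    | high g =>
      obtain ⟨x, hx, hg, -⟩ := ho
      refine (hstep x (fun h => absurd hx (hdeg x h).not_gt) g hg).trans ?_
      rw [pow_succ]
      linarith
    | full st =>
      set T := st.visited \ S with hT
      have h1 : st.visited.card ≤ T.card + S.card := by
        have : st.visited.card - S.card ≤ T.card := Finset.le_card_sdiff S st.visited
        omega
      have h2 := card_mul_le_card_pick (Finset.sdiff_subset : T ⊆ st.visited)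
      set U := Finset.univ.filter fun y => pick st.visited y ∈ T with hU
      -- More than half of the m = 2t + 1 visited nodes lie outside S; rounding n/m down loses at
      -- most another factor 2.
      have h3 : n ≤ 4 * U.card := by
        have hm := ho.2
        set m := st.visited.card
        have h4 : 0 < n / m := Nat.div_pos (by omega) (by omega)
        have h5 := Nat.lt_div_mul_add (a := n) (b := m) (by omega)
        have h6 : m ≤ 2 * T.card := by omega
        have h7 : n / m * m ≤ n / m * (2 * T.card) := Nat.mul_le_mul_left _ h6
        nlinarith
      have h8 := Algorithm.acc_sample_le_sub L
        (fun y => cutTest k (t + k) t v r (st.flow (pick st.visited y))) U (δ := (1 / 4) ^ r)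
        (fun y hy => by
          have hy := (Finset.mem_filter.mp hy).2
          obtain ⟨hy1, hy2⟩ := Finset.mem_sdiff.mp hy
          exact hstep _ hy2 _ (ho.1.isAugmentation _ hy1))
      refine h8.trans ?_
      have hn : (0 : ℝ) < n := by exact_mod_cast Nat.pos_of_ne_zero (NeZero.ne n)
      have h9 : (1 / 4 : ℝ) ≤ U.card / n := by
        rw [le_div_iff₀ hn]
        have : (n : ℝ) ≤ 4 * U.card := by exact_mod_cast h3
        linarith
      rw [pow_succ, mul_div_assoc]
      have := mul_le_mul_of_nonneg_left h9 hpow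
      linarith

/-- The local test for `k`-edge-connectivity. -/
noncomputable def edgeConnTest (k n : ℕ) (_d : ℝ) (t : ℕ) (v : Fin n) : Algorithm n :=
  cutTest k (t + k) t v (k - 1) fun _ _ => 0

lemma queries_edgeConnTest_le (L : IncidenceLists G) {k : ℕ} (hk : 1 ≤ k) (d : ℝ) {t : ℕ}
    (ht : 1 ≤ t) (v : Fin n) :
    (edgeConnTest k n d t v).queries L ≤ k * (3 * (k + 2) + 1) * t ^ 2 := by
  refine (queries_cutTest_le L IsFlow.zero _).trans ?_
  rw [Nat.sub_add_cancel hk, mul_assoc]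
  refine Nat.mul_le_mul_left _ ?_
  have h1 : 2 * t + 1 ≤ 3 * t := by omega
  have h2 : t + k + 1 ≤ (k + 2) * t := by nlinarith
  have h3 := Nat.mul_le_mul h1 h2
  nlinarith

lemma acc_edgeConnTest_le [NeZero n] (L : IncidenceLists G) {k t : ℕ} (d : ℝ) {v : Fin n}
    {S : Finset (Fin n)} (hv : v ∈ S) (hS : S.card ≤ t) (hcut : cutSize G S < k)
    (ht : 2 * t < n) : (edgeConnTest k n d t v).acc L ≤ 1 - (1 / 4) ^ (k - 1) :=
  acc_cutTest_le L (j := 0) hv hS hcut ht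
    ⟨IsFlow.zero, by simp [netFlow], by simp [netFlow], by simp [netFlow]⟩ (by omega)

end cutTest

/-! ### Deficient sets and the distance to k-edge-connectivity -/

section edgeConnectivity

variable {V : Type*} [Fintype V] [DecidableEq V] {G H : SimpleGraph V}

open Classical in
/-- The set of the edges that leave `S`. -/
noncomputable def cutEdges (G : SimpleGraph V) (S : Finset V) : Finset (Sym2 V) :=
  ((S ×ˢ Sᶜ).filter fun e => G.Adj e.1 e.2).image fun e => s(e.1, e.2)

lemma mem_cutEdges {S : Finset V} {e : Sym2 V} :
    e ∈ cutEdges G S ↔ ∃ x ∈ S, ∃ y ∉ S, G.Adj x y ∧ s(x, y) = e := by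
  simp only [cutEdges, Finset.mem_image, Finset.mem_filter, Finset.mem_product,
    Finset.mem_compl, Prod.exists]
  grind

lemma card_cutEdges (G : SimpleGraph V) (S : Finset V) : (cutEdges G S).card = cutSize G S := by
  classical
  rw [cutEdges, Finset.card_image_of_injOn]
  · rw [cutSize, Finset.card_filter, Finset.sum_product]
    exact Finset.sum_congr rfl fun x _ => (Finset.card_filter _ _).symm
  · rintro ⟨a, b⟩ h ⟨c, d⟩ h' heq
    simp only [Finset.coe_filter, Finset.mem_product, Finset.mem_compl, Set.mem_ofPred_eq] at h h'
    simp only [Sym2.eq_iff] at heq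
    grind

lemma cutSize_mono (h : G ≤ H) (S : Finset V) : cutSize G S ≤ cutSize H S := by
  rw [← card_cutEdges, ← card_cutEdges]
  refine Finset.card_le_card fun e he => ?_
  obtain ⟨x, hx, y, hy, hxy, rfl⟩ := mem_cutEdges.mp he
  exact mem_cutEdges.mpr ⟨x, hx, y, hy, h hxy, rfl⟩

lemma cutSize_compl (G : SimpleGraph V) (S : Finset V) : cutSize G Sᶜ = cutSize G S := by
  rw [← card_cutEdges, ← card_cutEdges]
  congr 1
  ext e
  simp only [mem_cutEdges, Finset.mem_compl, not_not]
  constructor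
  · rintro ⟨x, hx, y, hy, h, rfl⟩
    exact ⟨y, hy, x, hx, h.symm, Sym2.eq_swap⟩
  · rintro ⟨x, hx, y, hy, h, rfl⟩
    exact ⟨y, hy, x, hx, h.symm, Sym2.eq_swap⟩

omit [Fintype V] [DecidableEq V] in
lemma mem_of_reachable {S : Set V} (hS : ∀ x ∈ S, ∀ y, G.Adj x y → y ∈ S) {u v : V} (hu : u ∈ S)
    (h : G.Reachable u v) : v ∈ S := by
  obtain ⟨w⟩ := h
  induction w with
  | nil => exact hu
  | cons hadj _ ih => exact ih (hS _ hu _ hadj)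

/-- A graph is `k`-edge-connected if and only if every nontrivial cut has at least `k` edges. -/
lemma isEdgeConnected_iff_cutSize {k : ℕ} :
    G.IsEdgeConnected k ↔ ∀ S : Finset V, S.Nonempty → S ≠ Finset.univ → k ≤ cutSize G S := by
  classical
  constructor
  · rintro h S ⟨u, hu⟩ hS
    obtain ⟨v, hv⟩ : ∃ v, v ∉ S := by
      by_contra hcon
      push Not at hcon
      exact hS (Finset.eq_univ_iff_forall.mpr hcon)
    by_contra hlt
    have h1 : (cutEdges G S : Set (Sym2 V)).encard < k := by
      rw [Set.encard_coe_eq_coe_finsetCard, card_cutEdges]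
      exact_mod_cast not_le.mp hlt
    refine hv (mem_of_reachable (S := (S : Set V)) (fun x hx y hxy => ?_) hu (h u v h1))
    rw [SimpleGraph.deleteEdges_adj] at hxy
    by_contra hy
    exact hxy.2 (Finset.mem_coe.mpr (mem_cutEdges.mpr ⟨x, hx, y, hy, hxy.1, rfl⟩))
  · intro h u v s hs
    by_contra hr
    let S : Finset V := Finset.univ.filter fun x => (G.deleteEdges s).Reachable u x
    have h1 := h S ⟨u, by simp [S]⟩ fun e => hr (by
      have := Finset.mem_univ v
      rw [← e] at this
      exact (Finset.mem_filter.mp this).2)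
    have h2 : (cutEdges G S : Set (Sym2 V)) ⊆ s := by
      intro e he
      obtain ⟨x, hx, y, hy, hxy, rfl⟩ := mem_cutEdges.mp (Finset.mem_coe.mp he)
      by_contra hes
      refine hy ?_
      simp only [S, Finset.mem_filter, Finset.mem_univ, true_and] at hx ⊢
      exact hx.trans (SimpleGraph.Adj.reachable (SimpleGraph.deleteEdges_adj.mpr ⟨hxy, hes⟩))
    have h3 := Set.encard_le_encard h2
    rw [Set.encard_coe_eq_coe_finsetCard, card_cutEdges] at h3
    have h4 := h3.trans_lt hs
    have h5 : cutSize G S < k := by exact_mod_cast h4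
    omega

-- Counting ordered pairs makes the summand symmetric, so that inequalities between cuts can be
-- checked pair by pair.
open Classical in
lemma two_mul_cutSize (G : SimpleGraph V) (S : Finset V) :
    2 * cutSize G S = ∑ x, ∑ y, if G.Adj x y ∧ (x ∈ S ↔ y ∉ S) then 1 else 0 := by
  have h1 : ∀ T : Finset V, cutSize G T =
      ∑ x, ∑ y, if G.Adj x y ∧ x ∈ T ∧ y ∉ T then 1 else 0 := by
    intro T
    have h2 : ∀ x, (∑ y, if G.Adj x y ∧ x ∈ T ∧ y ∉ T then 1 else 0) =
        if x ∈ T then (Tᶜ.filter (G.Adj x)).card else 0 := by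
      intro x
      rw [← Finset.card_filter]
      split_ifs with hx
      · congr 1
        ext y
        simp [hx, and_comm]
      · simp [hx]
    simp only [h2, cutSize, Finset.sum_ite_mem, Finset.univ_inter]
  rw [two_mul]
  nth_rewrite 2 [← cutSize_compl]
  rw [h1, h1, ← Finset.sum_add_distrib]
  refine Finset.sum_congr rfl fun x _ => ?_
  rw [← Finset.sum_add_distrib]
  refine Finset.sum_congr rfl fun y _ => ?_
  by_cases hxy : G.Adj x y <;> by_cases hx : x ∈ S <;> by_cases hy : y ∈ S <;> simp [hxy, hx, hy]

/-- Posimodularity: the inequality holds for each ordered pair, by cases on membership in A and B.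
-/
lemma cutSize_sdiff_add_le (G : SimpleGraph V) (A B : Finset V) :
    cutSize G (A \ B) + cutSize G (B \ A) ≤ cutSize G A + cutSize G B := by
  classical
  suffices h : 2 * cutSize G (A \ B) + 2 * cutSize G (B \ A) ≤
      2 * cutSize G A + 2 * cutSize G B by omega
  simp only [two_mul_cutSize, ← Finset.sum_add_distrib]
  refine Finset.sum_le_sum fun x _ => Finset.sum_le_sum fun y _ => ?_
  by_cases hxy : G.Adj x y <;> by_cases hxA : x ∈ A <;> by_cases hyA : y ∈ A <;>
    by_cases hxB : x ∈ B <;> by_cases hyB : y ∈ B <;> simp [hxy, hxA, hyA, hxB, hyB]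

/-- A nontrivial set that is left by less than `k` edges. -/
def Deficient (G : SimpleGraph V) (k : ℕ) (S : Finset V) : Prop :=
  S.Nonempty ∧ S ≠ Finset.univ ∧ cutSize G S < k

/-- If A and B met, both differences would be nonempty proper subsets, hence left by at least k
edges each, against posimodularity. -/
lemma disjoint_of_minimal_deficient {k : ℕ} {A B : Finset V} (hA : Minimal (Deficient G k) A)
    (hB : Minimal (Deficient G k) B) (hne : A ≠ B) : Disjoint A B := by
  by_contra hdisj
  have aux : ∀ {A B : Finset V}, Minimal (Deficient G k) A → ¬ Disjoint A B →
      (A \ B).Nonempty → k ≤ cutSize G (A \ B) := by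
    intro A B hA hdisj hne
    by_contra hlt
    have h1 := hA.2 (y := A \ B) ⟨hne, fun h => hA.1.2.1 (Finset.eq_univ_iff_forall.mpr fun x =>
      (Finset.mem_sdiff.mp (h ▸ Finset.mem_univ x)).1), not_le.mp hlt⟩ Finset.sdiff_subset
    exact hdisj (Finset.disjoint_left.mpr fun x hx => (Finset.mem_sdiff.mp (h1 hx)).2)
  have h1 : (A \ B).Nonempty := by
    rw [Finset.sdiff_nonempty]
    exact fun h => hne (le_antisymm h (hB.2 hA.1 h))
  have h2 : (B \ A).Nonempty := by
    rw [Finset.sdiff_nonempty]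
    exact fun h => hne (le_antisymm (hA.2 hB.1 h) h)
  have h3 := aux hA hdisj h1
  have h4 := aux hB (fun h => hdisj h.symm) h2
  have h5 := cutSize_sdiff_add_le G A B
  have h6 := hA.1.2.2
  have h7 := hB.1.2.2
  omega

lemma Deficient.compl {k : ℕ} {S : Finset V} (h : Deficient G k S) : Deficient G k Sᶜ := by
  refine ⟨?_, ?_, by rw [cutSize_compl]; exact h.2.2⟩
  · rw [Finset.nonempty_iff_ne_empty, Ne, Finset.compl_eq_empty_iff]
    exact h.2.1
  · rw [Ne, Finset.compl_eq_univ_iff]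
    exact h.1.ne_empty

/-- Joining `k + 1` nodes to one node in each minimal deficient set makes a graph
`k`-edge-connected. -/
lemma exists_isEdgeConnected (G : SimpleGraph V) {k : ℕ} (hk : k + 1 ≤ Fintype.card V)
    (𝓢 : Finset (Finset V)) (h𝓢 : ∀ S, S ∈ 𝓢 ↔ Minimal (Deficient G k) S) :
    ∃ H : SimpleGraph V, H.IsEdgeConnected k ∧
      (symmDiff G.edgeSet H.edgeSet).ncard ≤ (k + 1) * 𝓢.card := by
  classical
  obtain ⟨K, -, hK⟩ := Finset.exists_subset_card_eq (s := (Finset.univ : Finset V)) (n := k + 1)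
    (by rwa [Finset.card_univ])
  have : Nonempty V := Fintype.card_pos_iff.mp (by omega)
  have hne : ∀ S ∈ 𝓢, S.Nonempty := fun S hS => ((h𝓢 S).mp hS).1.1
  choose! r hr using hne
  let E : Finset (Sym2 V) := (K ×ˢ 𝓢).image fun e => s(e.1, r e.2)
  let H : SimpleGraph V := G ⊔ SimpleGraph.fromEdgeSet (E : Set (Sym2 V))
  have hH : ∀ h ∈ K, ∀ S ∈ 𝓢, h ≠ r S → H.Adj h (r S) := by
    intro h hh S hS hne
    refine Or.inr ?_
    rw [SimpleGraph.fromEdgeSet_adj]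
    exact ⟨Finset.mem_coe.mpr (Finset.mem_image.mpr ⟨(h, S), by simp [hh, hS], rfl⟩), hne⟩
  refine ⟨H, ?_, ?_⟩
  · rw [isEdgeConnected_iff_cutSize]
    intro X hX hXu
    by_contra hlt
    have hdef : Deficient G k X :=
      ⟨hX, hXu, (cutSize_mono le_sup_left X).trans_lt (not_le.mp hlt)⟩
    obtain ⟨S, hSX, hS⟩ := exists_minimal_le_of_wellFoundedLT (Deficient G k) X hdef
    obtain ⟨T, hTX, hT⟩ := exists_minimal_le_of_wellFoundedLT (Deficient G k) Xᶜ hdef.compl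
    rw [← h𝓢] at hS hT
    have ha : r S ∈ X := hSX (hr S hS)
    have hb : r T ∉ X := Finset.mem_compl.mp (hTX (hr T hT))
    refine hlt ?_
    rw [← card_cutEdges]
    -- Each node of K yields an edge across X, to r T or to r S, whichever is on the other side. The
    -- nodes r S and r T would yield the same edge, so r S is dropped; hence k + 1 nodes in K.
    have h1 : k ≤ (K.erase (r S)).card := by
      have := Finset.pred_card_le_card_erase (s := K) (a := r S)
      omega
    refine h1.trans (Finset.card_le_card_of_injOn
      (fun h => if h ∈ X then s(h, r T) else s(r S, h)) ?_ ?_)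
    · intro h hh
      obtain ⟨hne, hhK⟩ := Finset.mem_erase.mp (Finset.mem_coe.mp hh)
      refine Finset.mem_coe.mpr (mem_cutEdges.mpr ?_)
      by_cases hhX : h ∈ X
      · exact ⟨h, hhX, r T, hb, hH h hhK T hT fun e => hb (e ▸ hhX), by simp [hhX]⟩
      · exact ⟨r S, ha, h, hhX, (hH h hhK S hS hne).symm, by simp [hhX]⟩
    · intro h hh h' hh' heq
      have hne := (Finset.mem_erase.mp (Finset.mem_coe.mp hh)).1
      have hne' := (Finset.mem_erase.mp (Finset.mem_coe.mp hh')).1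
      by_cases h1 : h ∈ X <;> by_cases h2 : h' ∈ X <;>
        simp only [h1, h2, if_true, if_false, Sym2.eq_iff] at heq <;> grind
  · have h1 : symmDiff G.edgeSet H.edgeSet ⊆ (E : Set (Sym2 V)) := by
      intro e he
      simp only [H, SimpleGraph.edgeSet_sup, SimpleGraph.edgeSet_fromEdgeSet, Set.mem_symmDiff,
        Set.mem_union, Set.mem_sdiff] at he
      grind
    calc (symmDiff G.edgeSet H.edgeSet).ncard ≤ (E : Set (Sym2 V)).ncard :=
          Set.ncard_le_ncard h1 E.finite_toSet
      _ = E.card := Set.ncard_coe_finset E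
      _ ≤ (K ×ˢ 𝓢).card := Finset.card_image_le
      _ = _ := by rw [Finset.card_product, hK]

end edgeConnectivity

theorem hasTester_isEdgeConnected {k a : ℕ} (hk : 1 ≤ k) (ha : 2 ≤ a) :
    HasTester (fun _ G => G.IsEdgeConnected k) a := by
  classical
  refine hasTester_of_localTest _ ha (k + 1) (k + 1) (k * (3 * (k + 2) + 1))
    (δ := (1 / 4) ^ (k - 1)) (by omega) (by positivity)
    (pow_le_one₀ (by norm_num) (by norm_num)) (edgeConnTest k) ?_ ?_ ?_ ?_
  · intro n _ hn
    -- For 2 ≤ n ≤ k no node can have degree k.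
    rcases Nat.lt_or_ge 1 n with h1 | h1
    · refine Or.inr fun G hG => ?_
      have : Nontrivial (Fin n) := Fin.nontrivial_iff_two_le.mpr h1
      have h2 := hG.le_degree (u := (0 : Fin n))
      have h3 := G.degree_lt_card_verts 0
      rw [Fintype.card_fin] at h3
      omega
    · refine Or.inl fun G => ?_
      have : Subsingleton (Fin n) := Fin.subsingleton_iff_le_one.mpr h1
      exact SimpleGraph.IsEdgeConnected.of_subsingleton
  · intro n _ G L t v hG
    exact acc_cutTest_of_sound L IsFlow.zero _ (isEdgeConnected_iff_cutSize.mp hG)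
  · intro n _ G L t v ht
    exact queries_edgeConnTest_le L hk _ ht v
  · intro n _ G ε _ hn hfar
    have h𝓢 : ∀ S, S ∈ Finset.univ.filter (Minimal (Deficient G k)) ↔
        Minimal (Deficient G k) S := by simp
    refine ⟨Finset.univ.filter (Minimal (Deficient G k)), ?_, ?_, ?_, ?_⟩
    · intro A hA B hB hne
      exact disjoint_of_minimal_deficient ((h𝓢 A).mp hA) ((h𝓢 B).mp hB) hne
    · exact fun S hS => ((h𝓢 S).mp hS).1.1
    · obtain ⟨H, hH, hcard⟩ := exists_isEdgeConnected G (by rwa [Fintype.card_fin]) _ h𝓢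
      exact (hfar H hH).le.trans (by exact_mod_cast hcard)
    · intro S hS t hSt ht L v hv
      exact acc_edgeConnTest_le L _ hv hSt ((h𝓢 S).mp hS).1.2.2 ht

/-! ### Eulerian graphs: Euler's theorem, parities and joining components -/

section euler

variable {V : Type*} [Fintype V] [DecidableEq V] {G H : SimpleGraph V}

/-- A trail that is not closed uses an odd number of edges at its start, so an even degree leaves
one unused. -/
lemma exists_adj_notMem_edges [DecidableRel G.Adj] {a b : V} (hdeg : Even (G.degree a))
    {p : G.Walk a b} (hp : p.IsTrail) (hab : a ≠ b) : ∃ z, G.Adj z a ∧ s(z, a) ∉ p.edges := by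
  by_contra! hcon
  have h1 : ¬ Even (p.edges.countP fun e => a ∈ e) := by
    rw [hp.even_countP_edges_iff]
    simp [hab]
  refine h1 ?_
  rw [← G.card_incidenceFinset_eq_degree] at hdeg
  convert hdeg
  rw [← Multiset.coe_countP, Multiset.countP_eq_card_filter]
  change (hp.edgesFinset.filter (a ∈ ·)).card = _
  congr 1
  ext e
  rw [Finset.mem_filter, SimpleGraph.mem_incidenceFinset]
  constructor
  · rintro ⟨h, ha⟩
    exact ⟨p.edges_subset_edgeSet h, ha⟩
  · rintro ⟨he, ha⟩
    obtain ⟨z, rfl⟩ := Sym2.mem_iff_exists.mp ha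
    refine ⟨?_, ha⟩
    have := hcon z (G.adj_symm he)
    rwa [Sym2.eq_swap] at this

/-- Euler's theorem. -/
theorem exists_isEulerian [Nonempty V] [DecidableRel G.Adj] (hdeg : ∀ x, Even (G.degree x))
    (hconn : ∀ x y z w, G.Adj x z → G.Adj y w → G.Reachable x y) :
    ∃ (v : V) (w : G.Walk v v), w.IsEulerian := by
  classical
  -- A longest trail is closed by parity. Rotated to any of its nodes it still cannot be extended,
  -- so it uses all edges there, and by connectivity all edges.
  let S : Set ℕ := {m | ∃ (a b : V) (p : G.Walk a b), p.IsTrail ∧ p.length = m}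
  have hbdd : BddAbove S := ⟨G.edgeFinset.card, by
    rintro m ⟨a, b, p, hp, rfl⟩
    exact hp.length_le_card_edgeFinset⟩
  have hS : S.Nonempty := ⟨0, Classical.arbitrary V, _, .nil, .nil, rfl⟩
  obtain ⟨a, b, p, hp, hlen⟩ := Nat.sSup_mem hS hbdd
  have hmax : ∀ {c d : V} (q : G.Walk c d), q.IsTrail → q.length ≤ p.length := fun q hq => by
    rw [hlen]
    exact le_csSup hbdd ⟨_, _, q, hq, rfl⟩
  have hext : ∀ {c d z : V} (q : G.Walk c d), q.IsTrail → q.length = p.length → G.Adj z c →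
      s(z, c) ∈ q.edges := by
    intro c d z q hq hl hz
    by_contra hcon
    have := hmax (.cons hz q) (hq.cons hz hcon)
    rw [SimpleGraph.Walk.length_cons] at this
    omega
  obtain rfl : a = b := by
    by_contra hab
    obtain ⟨z, hz, hzp⟩ := exists_adj_notMem_edges (hdeg a) hp hab
    exact hzp (hext p hp rfl hz)
  have hcov : ∀ u ∈ p.support, ∀ z, G.Adj z u → s(z, u) ∈ p.edges := by
    intro u hu z hz
    have := hext (p.rotate u hu) (hp.rotate hu) (by
      rw [← SimpleGraph.Walk.length_edges, ← SimpleGraph.Walk.length_edges,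
        (p.rotate_edges u hu).perm.length_eq]) hz
    rwa [(p.rotate_edges u hu).mem_iff] at this
  refine ⟨a, p, hp.isEulerian_of_forall_mem fun e he => ?_⟩
  induction e with
  | _ x y =>
    have hxy : G.Adj x y := he
    have hpos : 0 < p.length := hmax (.cons hxy .nil) (by simp)
    obtain ⟨z, haz⟩ : ∃ z, G.Adj a z := by
      cases p with
      | nil => simp at hpos
      | cons h _ => exact ⟨_, h⟩
    refine hcov y ?_ x hxy
    refine mem_of_reachable (S := {v | v ∈ p.support}) (fun v hv w hvw => ?_)
      p.start_mem_support (hconn a y z x haz hxy.symm)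
    exact p.fst_mem_support_of_mem_edges (hcov v hv w hvw.symm)

omit [Fintype V] in
lemma reachable_of_isEulerian {v : V} {w : G.Walk v v} (hw : w.IsEulerian) {x y z u : V}
    (hxz : G.Adj x z) (hyu : G.Adj y u) : G.Reachable x y := by
  have h : ∀ {x z : V}, G.Adj x z → G.Reachable v x := fun {x z} hxz =>
    ⟨w.takeUntil x (w.fst_mem_support_of_mem_edges (hw.mem_edges_iff.mpr hxz))⟩
  exact (h hxz).symm.trans (h hyu)

open Classical in
/-- The parity of the degree of a node. -/
noncomputable def parity (G : SimpleGraph V) (x : V) : ZMod 2 := ∑ y, if G.Adj x y then 1 else 0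

omit [DecidableEq V] in
lemma parity_eq_degree (G : SimpleGraph V) [DecidableRel G.Adj] (x : V) :
    parity G x = (G.degree x : ZMod 2) := by
  rw [← SimpleGraph.card_neighborFinset_eq_degree, SimpleGraph.neighborFinset_eq_filter,
    Finset.card_filter, parity]
  push_cast
  exact Finset.sum_congr rfl fun y _ => by congr

omit [DecidableEq V] in
lemma parity_eq_zero_iff (G : SimpleGraph V) [DecidableRel G.Adj] (x : V) :
    parity G x = 0 ↔ Even (G.degree x) := by
  rw [parity_eq_degree, ZMod.natCast_eq_zero_iff_even]

omit [DecidableEq V] in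
lemma sum_parity (G : SimpleGraph V) : ∑ x, parity G x = 0 := by
  classical
  simp_rw [parity_eq_degree]
  rw [← Nat.cast_sum, G.sum_degrees_eq_twice_card_edges, ZMod.natCast_eq_zero_iff_even]
  exact even_two_mul _

/-- Insert the edge `uv` if it is not present, and delete it otherwise. -/
def toggle (G : SimpleGraph V) (u v : V) : SimpleGraph V where
  Adj x y := x ≠ y ∧ (G.Adj x y ↔ s(x, y) ≠ s(u, v))
  symm := ⟨fun x y h => ⟨h.1.symm, by rw [G.adj_comm, Sym2.eq_swap]; exact h.2⟩⟩
  loopless := ⟨fun x h => h.1 rfl⟩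

omit [Fintype V] [DecidableEq V] in
lemma toggle_adj {x y u v : V} (huv : u ≠ v) :
    (toggle G u v).Adj x y ↔ (G.Adj x y ↔ s(x, y) ≠ s(u, v)) := by
  refine ⟨fun h => h.2, fun h => ⟨?_, h⟩⟩
  rintro rfl
  have : ¬ s(x, x) ≠ s(u, v) := fun h' => G.irrefl (h.mpr h')
  simp only [ne_eq, not_not, Sym2.eq_iff] at this
  grind

lemma parity_toggle {u v : V} (huv : u ≠ v) (x : V) : parity (toggle G u v) x =
    parity G x + (if x = u then 1 else 0) + (if x = v then 1 else 0) := by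
  classical
  have h : ∀ q r : V, (∑ y, if x = q ∧ y = r then (1 : ZMod 2) else 0) =
      if x = q then 1 else 0 := by
    intro q r
    by_cases hq : x = q <;> simp [hq]
  rw [← h u v, ← h v u, parity, parity, ← Finset.sum_add_distrib, ← Finset.sum_add_distrib]
  refine Finset.sum_congr rfl fun y _ => ?_
  have h2 : (1 : ZMod 2) + 1 = 0 := by decide
  by_cases hG : G.Adj x y <;> by_cases h1 : x = u ∧ y = v <;> by_cases h1' : x = v ∧ y = u <;>
    simp only [toggle_adj huv, hG, h1, h1', Ne, Sym2.eq_iff] <;> grind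

/-- The number of edge insertions and deletions that transform `G` into `H`. -/
noncomputable def editDist (G H : SimpleGraph V) : ℕ := (symmDiff G.edgeSet H.edgeSet).ncard

omit [Fintype V] [DecidableEq V] in
lemma editDist_self (G : SimpleGraph V) : editDist G G = 0 := by simp [editDist]

omit [DecidableEq V] in
lemma editDist_triangle (G H K : SimpleGraph V) :
    editDist G K ≤ editDist G H + editDist H K := by
  refine (Set.ncard_le_ncard (symmDiff_triangle G.edgeSet H.edgeSet K.edgeSet)
    (Set.toFinite _)).trans (Set.ncard_union_le _ _)

omit [Fintype V] in
lemma editDist_toggle (G : SimpleGraph V) {u v : V} (huv : u ≠ v) :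
    editDist G (toggle G u v) ≤ 1 := by
  rw [editDist, ← Set.ncard_singleton s(u, v)]
  refine Set.ncard_le_ncard (fun e he => ?_) (Set.finite_singleton _)
  induction e with
  | _ x y =>
    simp only [Set.mem_symmDiff, SimpleGraph.mem_edgeSet, toggle_adj huv] at he
    rw [Set.mem_singleton_iff]
    tauto

/-- The nodes of odd degree. -/
noncomputable def oddNodes (G : SimpleGraph V) : Finset V :=
  Finset.univ.filter fun x => parity G x ≠ 0

omit [DecidableEq V] in
lemma mem_oddNodes {x : V} : x ∈ oddNodes G ↔ parity G x ≠ 0 := by simp [oddNodes]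

/-- All degrees can be made even by toggling edges between nodes of odd degree. -/
lemma exists_parity_eq_zero (G : SimpleGraph V) : ∃ H : SimpleGraph V, (∀ x, parity H x = 0) ∧
    (∀ x y, x ∉ oddNodes G → (G.Adj x y ↔ H.Adj x y)) ∧
    editDist G H ≤ (oddNodes G).card := by
  induction hm : (oddNodes G).card using Nat.strong_induction_on generalizing G with
  | _ m ih =>
    by_cases hO : ∃ u, u ∈ oddNodes G
    · obtain ⟨u, hu⟩ := hO
      obtain ⟨v, huv, hv⟩ : ∃ v, u ≠ v ∧ v ∈ oddNodes G := by
        by_contra! hcon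
        have h1 := sum_parity G
        rw [Finset.sum_eq_single u (fun v _ hv => by
          have := hcon v hv.symm
          rwa [mem_oddNodes, not_not] at this) (by simp)] at h1
        exact mem_oddNodes.mp hu h1
      have h01 : ∀ c : ZMod 2, c ≠ 0 → c = 1 := by decide
      have h11 : (1 : ZMod 2) + 1 = 0 := by decide
      -- Both u and v become even; recording this for u alone already gives termination and the
      -- bound.
      have hodd : oddNodes (toggle G u v) ⊆ (oddNodes G).erase u := by
        intro x hx
        rw [mem_oddNodes, parity_toggle huv] at hx
        rw [Finset.mem_erase, mem_oddNodes]
        rw [mem_oddNodes] at hu hv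
        have hu := h01 _ hu
        have hv := h01 _ hv
        by_cases hxu : x = u
        · subst hxu
          simp [hu, huv, h11] at hx
        · refine ⟨hxu, ?_⟩
          by_cases hxv : x = v
          · subst hxv
            simp [hv]
          · simpa [hxu, hxv] using hx
      have hlt : (oddNodes (toggle G u v)).card < (oddNodes G).card :=
        (Finset.card_le_card hodd).trans_lt (Finset.card_erase_lt_of_mem hu)
      obtain ⟨H, h1, h2, h3⟩ := ih _ (hm ▸ hlt) (toggle G u v) rfl
      refine ⟨H, h1, fun x y hx => ?_, ?_⟩
      · rw [← h2 x y fun h => hx (Finset.mem_of_mem_erase (hodd h)), toggle_adj huv, Ne,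
          Sym2.eq_iff]
        have : ¬ (x = u ∧ y = v ∨ x = v ∧ y = u) := by
          rintro (⟨rfl, -⟩ | ⟨rfl, -⟩) <;> contradiction
        tauto
      · have h4 := editDist_triangle G (toggle G u v) H
        have h5 := editDist_toggle G huv
        omega
    · push Not at hO
      refine ⟨G, fun x => ?_, fun _ _ _ => Iff.rfl, by simp [editDist_self]⟩
      have := hO x
      rwa [mem_oddNodes, not_not] at this

omit [Fintype V] [DecidableEq V] in
lemma reachable_of_forall_adj (h : ∀ x y, G.Adj x y → H.Reachable x y) {x y : V}
    (hxy : G.Reachable x y) : H.Reachable x y := by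
  obtain ⟨w⟩ := hxy
  induction w with
  | nil => exact .rfl
  | cons hadj _ ih => exact (h _ _ hadj).trans ih

lemma iff_not_iff_not_iff_not {p q r s : Prop} (hqr : ¬ (q ∧ r)) (hqs : ¬ (q ∧ s))
    (hrs : ¬ (r ∧ s)) : (((p ↔ ¬ q) ↔ ¬ r) ↔ ¬ s) ↔ (p ↔ ¬ (q ∨ r ∨ s)) := by
  by_cases p <;> by_cases q <;> by_cases r <;> by_cases s <;> simp_all

/-- Components can be joined by toggling triangles. -/
lemma exists_join (X : Finset V) (hX : 3 ≤ X.card) (G : SimpleGraph V) (W : Finset V) (hW : W ⊆ X)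
    (hGX : ∀ x y, G.Adj x y → x ∈ X) (hcov : ∀ x ∈ X, ∃ w ∈ W, G.Reachable w x) :
    ∃ H : SimpleGraph V, (∀ x, parity H x = parity G x) ∧ (∀ x y, H.Adj x y → x ∈ X) ∧
      (∀ x ∈ X, ∀ y ∈ X, H.Reachable x y) ∧ editDist G H ≤ 3 * W.card := by
  induction hm : W.card generalizing G W with
  | zero =>
    rw [Finset.card_eq_zero] at hm
    obtain ⟨x, hx⟩ := Finset.card_pos.mp (lt_of_lt_of_le (by norm_num) hX)
    obtain ⟨w, hw, -⟩ := hcov x hx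
    simp [hm] at hw
  | succ m ih =>
    by_cases hW2 : ∃ a ∈ W, ∃ c ∈ W, ¬ G.Reachable a c
    · obtain ⟨a, ha, c, hc, hac⟩ := hW2
      have hac' : a ≠ c := by rintro rfl; exact hac .rfl
      obtain ⟨b, hb, hbn⟩ : ∃ b ∈ X, b ∉ ({a, c} : Finset V) :=
        Finset.exists_mem_notMem_of_card_lt_card
          (lt_of_le_of_lt Finset.card_le_two (by omega))
      simp only [Finset.mem_insert, Finset.mem_singleton, not_or] at hbn
      obtain ⟨hba, hbc⟩ := hbn
      -- As a and c lie in different components, ac is absent and b is adjacent to at most one of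
      -- them. Toggling the triangle adds ac and leaves b adjacent to at least one, so no connection
      -- is lost.
      let G' := toggle (toggle (toggle G a c) c b) b a
      have hadj : ∀ x y, G'.Adj x y ↔
          (G.Adj x y ↔ ¬ (s(x, y) = s(a, c) ∨ s(x, y) = s(c, b) ∨ s(x, y) = s(b, a))) := by
        intro x y
        have h1 : s(a, c) ≠ s(c, b) := by rw [Ne, Sym2.eq_iff]; tauto
        have h2 : s(a, c) ≠ s(b, a) := by rw [Ne, Sym2.eq_iff]; tauto
        have h3 : s(c, b) ≠ s(b, a) := by rw [Ne, Sym2.eq_iff]; tauto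
        simp only [G', toggle_adj hba, toggle_adj (Ne.symm hbc), toggle_adj hac']
        exact iff_not_iff_not_iff_not (fun h => h1 (h.1.symm.trans h.2))
          (fun h => h2 (h.1.symm.trans h.2)) (fun h => h3 (h.1.symm.trans h.2))
      have hG'ac : G'.Adj a c := by
        rw [hadj]
        have : ¬ G.Adj a c := fun h => hac h.reachable
        simp [this]
      have hab : G.Adj a b → G'.Adj c b := fun h => by
        rw [hadj]
        have : ¬ G.Adj c b := fun h' => hac (h.reachable.trans h'.symm.reachable)
        simp [this]
      have hcb : G.Adj c b → G'.Adj b a := fun h => by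
        rw [hadj]
        have : ¬ G.Adj b a := fun h' => hac (h'.symm.reachable.trans h.symm.reachable)
        simp [this]
      have hreach : ∀ x y, G.Adj x y → G'.Reachable x y := by
        intro x y hxy
        by_cases h : s(x, y) = s(a, c) ∨ s(x, y) = s(c, b) ∨ s(x, y) = s(b, a)
        · rw [Sym2.eq_iff, Sym2.eq_iff, Sym2.eq_iff] at h
          rcases h with (⟨rfl, rfl⟩ | ⟨rfl, rfl⟩) | (⟨rfl, rfl⟩ | ⟨rfl, rfl⟩) |
            (⟨rfl, rfl⟩ | ⟨rfl, rfl⟩)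
          · exact hG'ac.reachable
          · exact hG'ac.symm.reachable
          · exact hG'ac.symm.reachable.trans (hcb hxy).symm.reachable
          · exact (hcb hxy.symm).reachable.trans hG'ac.reachable
          · exact (hab hxy.symm).symm.reachable.trans hG'ac.symm.reachable
          · exact hG'ac.reachable.trans (hab hxy).reachable
        · exact ((hadj x y).mpr ⟨fun _ => h, fun _ => hxy⟩).reachable
      obtain ⟨H, h1, h2, h3, h4⟩ := ih G' (W.erase c) ((Finset.erase_subset _ _).trans hW) (by
        intro x y hxy
        by_cases hG : G.Adj x y
        · exact hGX x y hG
        · rw [hadj, iff_not_comm] at hxy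
          have := hxy.mpr hG
          simp only [Sym2.eq_iff] at this
          have haX := hW ha
          have hcX := hW hc
          grind) (by
        intro x hx
        obtain ⟨w, hw, hwx⟩ := hcov x hx
        have hwx' := reachable_of_forall_adj hreach hwx
        by_cases hwc : w = c
        · subst hwc
          exact ⟨a, Finset.mem_erase.mpr ⟨hac', ha⟩, hG'ac.reachable.trans hwx'⟩
        · exact ⟨w, Finset.mem_erase.mpr ⟨hwc, hw⟩, hwx'⟩) (by
        rw [Finset.card_erase_of_mem hc, hm, Nat.add_sub_cancel])
      refine ⟨H, fun x => ?_, h2, h3, ?_⟩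
      · rw [h1, parity_toggle hba, parity_toggle (Ne.symm hbc), parity_toggle hac']
        have h11 : (1 : ZMod 2) + 1 = 0 := by decide
        linear_combination ((if x = a then 1 else 0) + (if x = b then 1 else 0) +
          (if x = c then 1 else 0)) * h11
      · have e1 := editDist_triangle G (toggle G a c) (toggle (toggle G a c) c b)
        have e2 := editDist_triangle G (toggle (toggle G a c) c b) G'
        have e3 := editDist_triangle G G' H
        have e4 := editDist_toggle G hac'
        have e5 := editDist_toggle (toggle G a c) (Ne.symm hbc)
        have e6 : editDist (toggle (toggle G a c) c b) G' ≤ 1 := editDist_toggle _ hba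
        omega
    · push Not at hW2
      refine ⟨G, fun _ => rfl, hGX, fun x hx y hy => ?_, by simp [editDist_self]⟩
      obtain ⟨w, hw, hwx⟩ := hcov x hx
      obtain ⟨w', hw', hwy⟩ := hcov y hy
      exact hwx.symm.trans ((hW2 w hw w' hw').trans hwy)

omit [Fintype V] in
/-- If nodes of odd degree are added, then a set that meets all components of `G` meets all
components of a graph that differs from `G` only in edges between nodes of odd degree. -/
lemma exists_reachable_of_adj_iff {O W : Finset V}
    (hGH : ∀ x y, x ∉ O → (G.Adj x y ↔ H.Adj x y)) {w x : V} (hw : w ∈ W ∪ O)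
    (h : G.Reachable w x) : ∃ u ∈ W ∪ O, H.Reachable u x := by
  refine mem_of_reachable (G := G) (S := {x | ∃ u ∈ W ∪ O, H.Reachable u x}) ?_ ⟨w, hw, .rfl⟩ h
  rintro x ⟨u, hu, hux⟩ y hxy
  by_cases hx : x ∈ O
  · by_cases hy : y ∈ O
    · exact ⟨y, Finset.mem_union_right _ hy, .rfl⟩
    · exact ⟨u, hu, hux.trans ((hGH y x hy).mp hxy.symm).symm.reachable⟩
  · exact ⟨u, hu, hux.trans ((hGH x y hx).mp hxy).reachable⟩

end euler

section

variable {n : ℕ} {G H : SimpleGraph (Fin n)}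

lemma isEulerian_of_parity [NeZero n] (hG : ∀ x, parity G x = 0)
    (hconn : ∀ x y z w, G.Adj x z → G.Adj y w → G.Reachable x y) : IsEulerian G := by
  classical
  exact exists_isEulerian (fun x => (parity_eq_zero_iff G x).mp (hG x)) hconn

lemma IsEulerian.parity_eq_zero (h : IsEulerian G) (x : Fin n) : parity G x = 0 := by
  classical
  obtain ⟨v, w, hw⟩ := h
  rw [parity_eq_zero_iff, hw.even_degree_iff]
  simp

lemma IsEulerian.reachable (h : IsEulerian G) {x y z w : Fin n} (hx : G.Adj x z)
    (hy : G.Adj y w) : G.Reachable x y := by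
  obtain ⟨v, w, hw⟩ := h
  exact reachable_of_isEulerian hw hx hy

/-- The parity repair costs |O| for the set O of odd nodes. It changes only edges within O, so W ∪ O
meets all new components, and joining costs 3 per node. -/
lemma exists_connected_isEulerian [NeZero n] (hn : 3 ≤ n) (G : SimpleGraph (Fin n))
    (W : Finset (Fin n)) (hW : ∀ x, ∃ w ∈ W, G.Reachable w x) :
    ∃ H : SimpleGraph (Fin n), (H.Connected ∧ IsEulerian H) ∧
      editDist G H ≤ 4 * (oddNodes G).card + 3 * W.card := by
  obtain ⟨G', h1, h2, h3⟩ := exists_parity_eq_zero G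
  obtain ⟨H, h4, -, h5, h6⟩ := exists_join Finset.univ (by simpa using hn) G' (W ∪ oddNodes G)
    (Finset.subset_univ _) (by simp) (fun x _ => by
      obtain ⟨w, hw, hwx⟩ := hW x
      exact exists_reachable_of_adj_iff h2 (Finset.mem_union_left _ hw) hwx)
  have hreach : ∀ x y, H.Reachable x y := fun x y => h5 x (by simp) y (by simp)
  refine ⟨H, ⟨⟨hreach⟩, isEulerian_of_parity (fun x => (h4 x).trans (h1 x))
    fun x y _ _ _ _ => hreach x y⟩, ?_⟩
  have h7 := editDist_triangle G G' H
  have h8 := Finset.card_union_le W (oddNodes G)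
  omega

lemma exists_adj_of_reachable {x y z : Fin n} (hxz : G.Adj x z) (h : G.Reachable y x) :
    ∃ u, G.Adj y u := by
  obtain ⟨w⟩ := h
  cases w with
  | nil => exact ⟨z, hxz⟩
  | cons h _ => exact ⟨_, h⟩

/-- Here W need only meet the components with edges, so joining is confined to the non-isolated
nodes. Triangles need three of these; with fewer there cannot be two components with edges. -/
lemma exists_isEulerian_editDist_le [NeZero n] (G : SimpleGraph (Fin n))
    (W : Finset (Fin n)) (hW : ∀ x y, G.Adj x y → ∃ w ∈ W, G.Reachable w x) :
    ∃ H : SimpleGraph (Fin n), IsEulerian H ∧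
      editDist G H ≤ 4 * (oddNodes G).card + 3 * W.card := by
  classical
  obtain ⟨G', h1, h2, h3⟩ := exists_parity_eq_zero G
  let X : Finset (Fin n) := Finset.univ.filter fun x => ∃ y, G'.Adj x y
  have hX : ∀ x, x ∈ X ↔ ∃ y, G'.Adj x y := by simp [X]
  rcases Nat.lt_or_ge X.card 3 with hcard | hcard
  · refine ⟨G', isEulerian_of_parity h1 fun x y z w hxz hyw => ?_, by omega⟩
    by_contra hcon
    have hxy : x ≠ y := by rintro rfl; exact hcon .rfl
    have hzy : z ≠ y := by rintro rfl; exact hcon hxz.reachable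
    have h4 : ({x, z, y} : Finset (Fin n)) ⊆ X := by
      intro u hu
      simp only [Finset.mem_insert, Finset.mem_singleton] at hu
      rw [hX]
      rcases hu with rfl | rfl | rfl
      exacts [⟨_, hxz⟩, ⟨_, hxz.symm⟩, ⟨_, hyw⟩]
    have h5 := Finset.card_le_card h4
    rw [Finset.card_eq_three.mpr ⟨x, z, y, hxz.ne, hxy, hzy, rfl⟩] at h5
    omega
  · obtain ⟨H, h4, h5, h6, h7⟩ := exists_join X hcard G' ((W ∪ oddNodes G) ∩ X)
      Finset.inter_subset_right (fun x y hxy => (hX x).mpr ⟨y, hxy⟩) (fun x hx => by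
        obtain ⟨y, hxy⟩ := (hX x).mp hx
        obtain ⟨u, hu, hux⟩ : ∃ u ∈ W ∪ oddNodes G, G'.Reachable u x := by
          by_cases hxO : x ∈ oddNodes G
          · exact ⟨x, Finset.mem_union_right _ hxO, .rfl⟩
          · obtain ⟨w, hw, hwx⟩ := hW x y ((h2 x y hxO).mpr hxy)
            exact exists_reachable_of_adj_iff h2 (Finset.mem_union_left _ hw) hwx
        exact ⟨u, Finset.mem_inter.mpr ⟨hu, (hX u).mpr (exists_adj_of_reachable hxy hux)⟩, hux⟩)
    refine ⟨H, isEulerian_of_parity (fun x => (h4 x).trans (h1 x)) fun x y z w hxz hyw =>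
      h6 x (h5 _ _ hxz) y (h5 _ _ hyw), ?_⟩
    have h8 := editDist_triangle G G' H
    have h9 := Finset.card_union_le W (oddNodes G)
    have h10 := Finset.card_le_card
      (Finset.inter_subset_left : (W ∪ oddNodes G) ∩ X ⊆ W ∪ oddNodes G)
    omega

/-! ### Testing single components -/

open Classical in
/-- The least nodes of the components. -/
noncomputable def componentReps (G : SimpleGraph (Fin n)) : Finset (Fin n) :=
  Finset.univ.filter fun x => ∀ y, G.Reachable x y → x ≤ y

lemma mem_componentReps {x : Fin n} :
    x ∈ componentReps G ↔ ∀ y, G.Reachable x y → x ≤ y := by simp [componentReps]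

lemma exists_mem_componentReps (G : SimpleGraph (Fin n)) (x : Fin n) :
    ∃ w ∈ componentReps G, G.Reachable w x := by
  classical
  obtain ⟨w, hw, hmin⟩ := Finset.exists_min_image
    (Finset.univ.filter fun y => G.Reachable y x) id ⟨x, by simp⟩
  simp only [Finset.mem_filter, Finset.mem_univ, true_and, id] at hw hmin
  exact ⟨w, mem_componentReps.mpr fun y hy => hmin y (hy.symm.trans hw), hw⟩

lemma eq_of_mem_componentReps {x y : Fin n} (hx : x ∈ componentReps G)
    (hy : y ∈ componentReps G) (h : G.Reachable x y) : x = y :=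
  le_antisymm (mem_componentReps.mp hx y h) (mem_componentReps.mp hy x h.symm)

open Classical in
/-- Accept unless the search has found a component that does not have the property `ok`. -/
noncomputable def componentStep (ok : SearchState n → Prop) : SearchOutcome n → Algorithm n
  | .closed st => .answer (decide (ok st))
  | .high _ => .answer true
  | .full _ => .answer true

open Classical in
/-- Reject if the degree of `v` is odd, or if `v` lies in a component with at most `t` nodes that
does not have the property `ok`. -/
noncomputable def componentTest (ok : ∀ n : ℕ, ℝ → SearchState n → Prop) (n : ℕ) (d : ℝ) (t : ℕ)
    (v : Fin n) : Algorithm n :=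
  .degree v fun m => if Odd m then .answer false
    else searchFrom v (fun _ _ => 0) t t (componentStep (ok n d))

lemma card_nbrs_eq_degree (L : IncidenceLists G) [DecidableRel G.Adj] (v : Fin n) :
    (L.nbrs v).card = G.degree v := by
  rw [← SimpleGraph.card_neighborFinset_eq_degree]
  congr 1
  ext w
  simp

lemma odd_length_iff (L : IncidenceLists G) (v : Fin n) :
    Odd (L.list v).length ↔ parity G v ≠ 0 := by
  classical
  rw [Ne, parity_eq_zero_iff, ← L.card_nbrs, card_nbrs_eq_degree, Nat.not_even_iff_odd]

variable {ok : ∀ n : ℕ, ℝ → SearchState n → Prop}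

lemma queries_componentTest_le (L : IncidenceLists G) (d : ℝ) {t : ℕ} (ht : 1 ≤ t) (v : Fin n) :
    (componentTest ok n d t v).queries L ≤ 7 * t ^ 2 := by
  have h1 : (searchFrom v (fun _ _ => 0) t t (componentStep (ok n d))).queries L ≤
      (2 * t + 1) * (t + 1) + 0 := queries_searchFrom_le L (G := G) IsFlow.zero fun o _ => by
    cases o <;> simp [componentStep, Algorithm.queries]
  simp only [componentTest, Algorithm.queries]
  split_ifs
  · simp only [Algorithm.queries]
    nlinarith
  · nlinarith

lemma acc_componentTest_of_sound (L : IncidenceLists G) (d : ℝ) (t : ℕ) (v : Fin n)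
    (hG : parity G v = 0) (hok : ∀ st : SearchState n, st.Valid L (fun _ _ => 0) v →
      Saturated G (fun _ _ => 0) st.visited → ok n d st) :
    (componentTest ok n d t v).acc L = 1 := by
  have h : ¬ Odd (L.list v).length := by rw [odd_length_iff]; exact not_not.mpr hG
  simp only [componentTest, Algorithm.acc, if_neg h]
  refine acc_searchFrom_of_forall L IsFlow.zero fun o ho => ?_
  cases o with
  | closed st => simp [componentStep, Algorithm.acc, hok st ho.1 ho.2.2]
  | high g => simp [componentStep, Algorithm.acc]
  | full st => simp [componentStep, Algorithm.acc]

lemma acc_componentTest_of_odd (L : IncidenceLists G) (d : ℝ) (t : ℕ) {v : Fin n}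
    (hv : parity G v ≠ 0) : (componentTest ok n d t v).acc L = 0 := by
  simp [componentTest, Algorithm.acc, (odd_length_iff L v).mpr hv]

/-- No edge leaves S, so degrees in S are at most t and the search must close inside S. -/
lemma acc_componentTest_of_component (L : IncidenceLists G) (d : ℝ) {t : ℕ} {v : Fin n}
    {S : Finset (Fin n)} (hv : v ∈ S) (hS : Saturated G (fun _ _ => 0) S) (ht : S.card ≤ t)
    (hok : ∀ st : SearchState n, st.Valid L (fun _ _ => 0) v → st.visited ⊆ S → ¬ ok n d st) :
    (componentTest ok n d t v).acc L = 0 := by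
  simp only [componentTest, Algorithm.acc]
  split_ifs
  · simp [Algorithm.acc]
  · have hcut : cutSize G S = 0 := by
      have := hS.cutSize_le IsFlow.zero
      simp only [netFlow, Finset.sum_const_zero] at this
      omega
    have hdeg : ∀ x ∈ S, (L.nbrs x).card ≤ t := fun x hx =>
      (card_nbrs_le_add_cutSize L hx).trans (by omega)
    obtain ⟨o, ho, hr⟩ := exists_reduces_searchFrom L IsFlow.zero (t := t) (hdeg v hv)
      (componentStep (ok n d))
    rw [hr.1]
    cases o with
    | closed st =>
      simp [componentStep, Algorithm.acc, hok st ho.1 (ho.1.subset S hv hS)]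
    | high g =>
      obtain ⟨x, hx, -, h⟩ := ho
      exact absurd hx (hdeg x (h S hv hS)).not_gt
    | full st =>
      have h1 := Finset.card_le_card (ho.1.subset S hv hS)
      have := ho.2
      omega

end

/-- The distance is at most 4|O| + 3|W|, hence 7 times the larger of |O| and |W|. The witnesses are
the odd singletons or the components of W accordingly, so components matter only if they outnumber
the odd nodes. -/
theorem hasTester_of_componentTest (P : ∀ n : ℕ, SimpleGraph (Fin n) → Prop) (n₀ : ℕ)
    (ok : ∀ n : ℕ, ℝ → SearchState n → Prop)
    (hsmall : ∀ (n : ℕ) [NeZero n], n < n₀ → (∀ G, P n G) ∨ ∀ G, ¬ P n G)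
    (hparity : ∀ (n : ℕ) (G : SimpleGraph (Fin n)), P n G → ∀ x, parity G x = 0)
    (hok : ∀ (n : ℕ) [NeZero n] (G : SimpleGraph (Fin n)) (L : IncidenceLists G) (v : Fin n)
      (st : SearchState n), P n G → st.Valid L (fun _ _ => 0) v →
      Saturated G (fun _ _ => 0) st.visited → ok n (avgDegree G) st)
    (hfar : ∀ (n : ℕ) [NeZero n] (G : SimpleGraph (Fin n)), n₀ ≤ n → ¬ P n G →
      ∃ W ⊆ componentReps G,
        (∃ H, P n H ∧ editDist G H ≤ 4 * (oddNodes G).card + 3 * W.card) ∧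
        (W.card ≤ (oddNodes G).card ∨ ∀ w ∈ W, ∀ (L : IncidenceLists G) (v : Fin n)
          (st : SearchState n), G.Reachable w v → st.Valid L (fun _ _ => 0) v →
          (∀ x ∈ st.visited, G.Reachable w x) → ¬ ok n (avgDegree G) st)) :
    HasTester P 2 := by
  classical
  refine hasTester_of_localTest P le_rfl n₀ 7 7 (δ := 1) (by norm_num) one_pos le_rfl
    (componentTest ok) hsmall ?_ ?_ ?_
  · intro n _ G L t v hG
    exact acc_componentTest_of_sound L _ t v (hparity n G hG v) fun st => hok n G L v st hG
  · intro n _ G L t v ht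
    exact queries_componentTest_le L _ ht v
  · intro n _ G ε hε hn hf
    obtain ⟨W, hW, ⟨H, hH, hdist⟩, hcases⟩ := hfar n G hn fun h => not_isFar_of_prop hε h hf
    have h1 : ε * G.edgeSet.ncard ≤ 4 * (oddNodes G).card + 3 * W.card :=
      (hf H hH).le.trans (by exact_mod_cast hdist)
    by_cases hWO : W.card ≤ (oddNodes G).card
    · refine ⟨(oddNodes G).image fun x => {x}, ?_, ?_, ?_, ?_⟩
      · intro A hA B hB hne
        obtain ⟨x, -, rfl⟩ := Finset.mem_image.mp (Finset.mem_coe.mp hA)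
        obtain ⟨y, -, rfl⟩ := Finset.mem_image.mp (Finset.mem_coe.mp hB)
        have : x ≠ y := fun h => hne (by rw [h])
        simpa [Function.onFun] using this
      · intro S hS
        obtain ⟨x, -, rfl⟩ := Finset.mem_image.mp hS
        simp
      · rw [Finset.card_image_of_injective _ Finset.singleton_injective]
        have : (W.card : ℝ) ≤ (oddNodes G).card := by exact_mod_cast hWO
        push_cast
        linarith
      · intro S hS t _ _ L v hv
        obtain ⟨x, hx, rfl⟩ := Finset.mem_image.mp hS
        obtain rfl := Finset.mem_singleton.mp hv
        rw [acc_componentTest_of_odd L _ t (mem_oddNodes.mp hx), sub_self]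
    · have hcases := hcases.resolve_left hWO
      let comp : Fin n → Finset (Fin n) := fun w => Finset.univ.filter (G.Reachable w)
      have hcomp : ∀ w x, x ∈ comp w ↔ G.Reachable w x := by simp [comp]
      refine ⟨W.image comp, ?_, ?_, ?_, ?_⟩
      · intro A hA B hB hne
        obtain ⟨x, hx, rfl⟩ := Finset.mem_image.mp (Finset.mem_coe.mp hA)
        obtain ⟨y, hy, rfl⟩ := Finset.mem_image.mp (Finset.mem_coe.mp hB)
        refine Finset.disjoint_left.mpr fun z hz hz' => hne ?_
        rw [eq_of_mem_componentReps (hW hx) (hW hy)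
          (((hcomp x z).mp hz).trans ((hcomp y z).mp hz').symm)]
      · intro S hS
        obtain ⟨x, -, rfl⟩ := Finset.mem_image.mp hS
        exact ⟨x, (hcomp x x).mpr .rfl⟩
      · rw [Finset.card_image_of_injOn fun x hx y hy h => eq_of_mem_componentReps (hW hx) (hW hy)
          ((hcomp x y).mp (by rw [show comp x = comp y from h]; exact (hcomp y y).mpr .rfl))]
        have : ((oddNodes G).card : ℝ) ≤ W.card := by exact_mod_cast (not_le.mp hWO).le
        push_cast
        linarith
      · intro S hS t ht _ L v hv
        obtain ⟨w, hw, rfl⟩ := Finset.mem_image.mp hS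
        rw [acc_componentTest_of_component L _ hv (fun x hx y hy hxy => ?_) ht
          fun st hst hsub => hcases w hw L v st ((hcomp w v).mp hv) hst
            fun x hx => (hcomp w x).mp (hsub hx), sub_self]
        exact absurd ((hcomp w y).mpr (((hcomp w x).mp hx).trans hxy.reachable)) hy

lemma sum_card_nbrs {n : ℕ} [NeZero n] {G : SimpleGraph (Fin n)} (L : IncidenceLists G) :
    ((∑ v, (L.nbrs v).card : ℕ) : ℝ) = n * avgDegree G := by
  classical
  simp_rw [card_nbrs_eq_degree]
  rw [G.sum_degrees_eq_twice_card_edges, mul_avgDegree, Set.ncard_eq_toFinset_card']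
  push_cast
  congr

lemma Saturated.mem_of_reachable {n : ℕ} {G : SimpleGraph (Fin n)} {S : Finset (Fin n)}
    (hS : Saturated G (fun _ _ => 0) S) {x y : Fin n} (hx : x ∈ S) (h : G.Reachable x y) :
    y ∈ S := by
  refine SparseGraphTesting.mem_of_reachable (S := (S : Set (Fin n))) (fun u hu w huw => ?_) hx h
  by_contra hw
  exact absurd (hS u hu w hw huw) (by norm_num)

theorem hasTester_connected_isEulerian :
    HasTester (fun _ G => G.Connected ∧ IsEulerian G) 2 := by
  classical
  refine hasTester_of_componentTest _ 3 (fun n _ st => st.visited = Finset.univ) ?_ ?_ ?_ ?_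
  · intro n _ hn
    have hpos := Nat.pos_of_ne_zero (NeZero.ne n)
    rcases Nat.lt_or_ge 1 n with h1 | h1
    · refine Or.inr fun G hG => ?_
      have : Nontrivial (Fin n) := Fin.nontrivial_iff_two_le.mpr h1
      have h2 := (SimpleGraph.isEdgeConnected_one.mpr hG.1.preconnected).le_degree
        (u := (0 : Fin n))
      have h3 := G.degree_lt_card_verts 0
      obtain ⟨m, hm⟩ := (parity_eq_zero_iff G 0).mp (hG.2.parity_eq_zero 0)
      rw [Fintype.card_fin] at h3
      omega
    · refine Or.inl fun G => ?_
      have : Subsingleton (Fin n) := Fin.subsingleton_iff_le_one.mpr h1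
      refine ⟨⟨fun x y => .of_subsingleton⟩, isEulerian_of_parity (fun x => ?_)
        fun x y _ _ _ _ => .of_subsingleton⟩
      simp [parity, Subsingleton.elim _ x]
  · exact fun n G hG => hG.2.parity_eq_zero
  · intro n _ G L v st hG hst hsat
    exact Finset.eq_univ_iff_forall.mpr fun y =>
      hsat.mem_of_reachable hst.mem (hG.1.preconnected v y)
  · intro n _ G hn hG
    refine ⟨componentReps G, subset_rfl,
      exists_connected_isEulerian hn G _ (exists_mem_componentReps G), ?_⟩
    by_cases hcard : (componentReps G).card ≤ (oddNodes G).card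
    · exact Or.inl hcard
    refine Or.inr fun w hw L v st _ _ hreach huniv => hG ?_
    -- If the explored component were everything, |O| < |W| ≤ 1 would make G connected with even
    -- degrees.
    have hall : ∀ x y, G.Reachable x y := fun x y =>
      (hreach x (by simp [huniv])).symm.trans (hreach y (by simp [huniv]))
    have h1 : (componentReps G).card ≤ 1 := Finset.card_le_one.mpr fun x hx y hy =>
      eq_of_mem_componentReps hx hy (hall x y)
    have h2 : oddNodes G = ∅ := Finset.card_eq_zero.mp (by omega)
    exact ⟨⟨hall⟩, isEulerian_of_parity (fun x => by
      by_contra hx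
      simpa [h2] using mem_oddNodes.mpr hx) fun x y _ _ _ _ => hall x y⟩

/-- Knowing d, the tester knows the degree sum nd, so an explored component reveals whether it has
all the edges. A component with some but not all edges is a refutation. -/
theorem hasTester_isEulerian : HasTester (fun _ G => IsEulerian G) 2 := by
  classical
  refine hasTester_of_componentTest _ 0 (fun n d st =>
    ∑ p ∈ st.visited, (st.nbrs p).card = 0 ∨
      n * d ≤ (∑ p ∈ st.visited, (st.nbrs p).card : ℕ)) ?_ ?_ ?_ ?_
  · intro n _ hn
    omega
  · exact fun n G hG => hG.parity_eq_zero
  · intro n _ G L v st hG hst hsat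
    rw [Finset.sum_congr rfl fun p hp => congrArg Finset.card (hst.nbrs_eq p hp),
      or_iff_not_imp_left]
    intro hne
    obtain ⟨p, hp, hpne⟩ := Finset.exists_ne_zero_of_sum_ne_zero hne
    obtain ⟨q, hq⟩ := Finset.card_ne_zero.mp hpne
    rw [L.mem_nbrs] at hq
    rw [← sum_card_nbrs L]
    refine le_of_eq (congrArg _ (Finset.sum_subset (Finset.subset_univ _) fun y _ hy => ?_).symm)
    rw [Finset.card_eq_zero, Finset.eq_empty_iff_forall_notMem]
    intro z hz
    exact hy (hsat.mem_of_reachable hp (hG.reachable hq ((L.mem_nbrs y z).mp hz)))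
  · intro n _ G hn hG
    refine ⟨(componentReps G).filter fun w => ∃ y, G.Adj w y, Finset.filter_subset _ _,
      exists_isEulerian_editDist_le G _ fun x y hxy => ?_, ?_⟩
    · obtain ⟨w, hw, hwx⟩ := exists_mem_componentReps G x
      exact ⟨w, Finset.mem_filter.mpr ⟨hw, exists_adj_of_reachable hxy hwx⟩, hwx⟩
    set W := (componentReps G).filter fun w => ∃ y, G.Adj w y with hW
    by_cases hcard : W.card ≤ (oddNodes G).card
    · exact Or.inl hcard
    have hW1 : 1 < W.card := by
      by_contra hle
      have h2 : oddNodes G = ∅ := Finset.card_eq_zero.mp (by omega)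
      have h3 := Finset.card_le_one.mp (not_lt.mp hle)
      refine hG (isEulerian_of_parity (fun x => by
        by_contra hx
        simpa [h2] using mem_oddNodes.mpr hx) fun x y z w hxz hyw => ?_)
      obtain ⟨a, ha, hax⟩ := exists_mem_componentReps G x
      obtain ⟨b, hb, hby⟩ := exists_mem_componentReps G y
      obtain rfl := h3 a (Finset.mem_filter.mpr ⟨ha, exists_adj_of_reachable hxz hax⟩)
        b (Finset.mem_filter.mpr ⟨hb, exists_adj_of_reachable hyw hby⟩)
      exact hax.symm.trans hby
    refine Or.inr fun w hw L v st hwv hst hreach hor => ?_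
    rw [Finset.sum_congr rfl fun p hp => congrArg Finset.card (hst.nbrs_eq p hp)] at hor
    obtain ⟨hw1, y, hwy⟩ := Finset.mem_filter.mp hw
    obtain ⟨u, hvu⟩ := exists_adj_of_reachable hwy hwv.symm
    rcases hor with h0 | hle
    · have := Finset.sum_eq_zero_iff.mp h0 v hst.mem
      rw [Finset.card_eq_zero] at this
      have hu := (L.mem_nbrs v u).mpr hvu
      simp [this] at hu
    · obtain ⟨w', hw', hne⟩ := Finset.exists_mem_ne hW1 w
      obtain ⟨hw1', y', hwy'⟩ := Finset.mem_filter.mp hw'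
      rw [← sum_card_nbrs L, Nat.cast_le] at hle
      refine absurd hle (not_le.mpr (Finset.sum_lt_sum_of_subset (Finset.subset_univ _)
        (Finset.mem_univ w') (fun hmem => hne ?_) ?_ fun _ _ _ => Nat.zero_le _))
      · exact (eq_of_mem_componentReps hw1 hw1' (hreach w' hmem)).symm
      · exact Finset.card_pos.mpr ⟨y', (L.mem_nbrs w' y').mpr hwy'⟩

theorem hasTester_connected : HasTester (fun _ G => G.Connected) 2 := by
  have h : HasTester (fun _ G => G.IsEdgeConnected 1) 2 :=
    hasTester_isEdgeConnected le_rfl le_rfl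
  -- The properties agree only for n ≥ 1, since `Connected` demands a node.
  have e : ∀ (n : ℕ) [NeZero n],
      (fun G : SimpleGraph (Fin n) => G.Connected) = fun G => G.IsEdgeConnected 1 := by
    intro n _
    funext G
    rw [SimpleGraph.isEdgeConnected_one, SimpleGraph.connected_iff, eq_iff_iff]
    exact and_iff_left inferInstance
  obtain ⟨C, T, hT⟩ := h
  refine ⟨C, T, fun n _ ε p hε hp0 hp1 G L => ?_⟩
  have h1 := hT n ε p hε hp0 hp1 G L
  simp only [← e n] at h1
  rwa [← congrFun (e n) G] at h1

end SparseGraphTesting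

theorem mainTheorem1 :
    SparseGraphTesting.HasTester (fun _ G => G.Connected) 2 ∧
    SparseGraphTesting.HasTester (fun _ G => G.IsEdgeConnected 2) 2 ∧
    SparseGraphTesting.HasTester (fun _ G => SparseGraphTesting.IsEulerian G) 2 ∧
    SparseGraphTesting.HasTester (fun _ G => G.Connected ∧ SparseGraphTesting.IsEulerian G) 2 ∧
    SparseGraphTesting.HasTester (fun _ G => G.IsEdgeConnected 3) 3 :=
  ⟨SparseGraphTesting.hasTester_connected,
    SparseGraphTesting.hasTester_isEdgeConnected (by norm_num) le_rfl,
    SparseGraphTesting.hasTester_isEulerian,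
    SparseGraphTesting.hasTester_connected_isEulerian,
    SparseGraphTesting.hasTester_isEdgeConnected (by norm_num) (by norm_num)⟩
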